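/- All graphs are finite and simple; $\deg(v)$ is the degree of $v$ in $G$, a $k$-vertex is a vertex of degree $k$, and a $k^-$-vertex is a vertex of degree at most $k$. An $(a_1,\dots,a_k)$-path in $G$ is a path $v_1\cdots v_k$ with $\deg(v_i)=a_i$ for all $i$. A $(k;a_1,\dots,a_k)$-star is a $k$-vertex together with its $k$ neighbours, the neighbours having degrees $a_1,\dots,a_k$ in some order ($a_i=b^-$ means degree at most $b$). Let $w$ be a $k$-vertex of $G$ with neighbours $u_1,\dots,u_k$. We say that $u_i$ is of type $1$ if $\deg(u_i)=2$, and of type $2$ if $\deg(u_i)=2$ and the neighbour of $u_i$ other than $w$ also has degree $2$ (so type $2$ implies type $1$). A configuration $\langle t_1,\dots,t_k\rangle$ is a $k$-vertex $w$ whose neighbours can be numbered $u_1,\dots,u_k$ such that $u_i$ is of type $t_i$ when $t_i\in\{1,2\}$, while $t_i=[d]$ (respectively $t_i=[d^-]$) means that $\deg(u_i)=d$ (respectively $\deg(u_i)\le d$). (It is understood that $w$, its neighbours, and, for the neighbours of type $1$ or $2$, the further vertices of the path leaving $w$ through $u_i$ up to and including the first vertex after the one or two prescribed $2$-vertices, are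 pairwise distinct; this is automatic when the girth is at least $8$.) Put (a) $\langle 2,1,1\rangle$; (b) $\langle 2,2,[3]\rangle$; (c) $\langle 2,2,2,1\rangle$; (d) $\langle 2,2,1,1\rangle$; (e) $\langle 2,2,2,[5^-]\rangle$; (f) $\langle 2,1,1,1\rangle$; (g) $\langle 2,2,1,[7^-]\rangle$; (h) $\langle 2,2,2,2,1\rangle$; (i) $\langle 2,2,2,2,[7^-]\rangle$; (j) $\langle 2,2,2,1,1\rangle$; (k) $\langle 2,2,2,2,2,1\rangle$; (l) $\langle 2,2,2,2,2,2,2\rangle$. **Corollary.** Let $G$ be a planar graph with minimum degree $\delta(G)=2$ and girth at least $g$. 1. If $g\ge 12$, then $G$ contains a $(2,2,2)$-path, or a configuration (a) or (b). 2. If $g\ge 10$, then $G$ contains a $(2,2,2)$-path, a $(2,2,3,2)$-path, a $(3;2,2,2)$-star, or a configuration (c). 3. If $g\ge 9$, then $G$ contains a $(2,2,2)$-path, a $(2,2,3)$-path, a $(3;2,2,5^-)$-star, or a configuration (d), (e) or (h). 4. If $g\ge 8$, then $G$ contains a $(2,2,2)$-path, a $(2,2,3)$-path, a $(2,3,2)$-path,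 or a configuration (f), (g), (i), (j), (k) or (l). -/

import Mathlib

namespace LightSubgraph

/-! ### Planarity: drawings in the plane whose edges are polygonal arcs -/

/-- The union of the straight line segments joining consecutive points of a list. -/
def polyline : List (ℝ × ℝ) → Set (ℝ × ℝ)
  | [] => ∅
  | [p] => {p}
  | p :: q :: l => segment ℝ p q ∪ polyline (q :: l)

/-- The broken line through the points of the list is simple: every segment is nondegenerate and
meets the rest of the broken line that comes after it only in its own end point. -/
def IsSimplePolyline : List (ℝ × ℝ) → Prop
  | [] => False
  | [_] => True
  | p :: q :: l =>
      p ≠ q ∧ segment ℝ p q ∩ polyline (q :: l) = {q} ∧ IsSimplePolyline (q :: l)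

/-- `A` is a polygonal arc in the plane with end points `p` and `q`. -/
def IsPolygonalArc (p q : ℝ × ℝ) (A : Set (ℝ × ℝ)) : Prop :=
  ∃ l : List (ℝ × ℝ),
    l.head? = some p ∧ l.getLast? = some q ∧ IsSimplePolyline l ∧ polyline l = A

/-- A drawing of `G` in the plane without crossings: the vertices are distinct points, each edge
is a polygonal arc joining its two ends and containing no other vertex, and two different edges
meet only in common ends. -/
structure PlaneDrawing {V : Type*} (G : SimpleGraph V) where
  pos : V → ℝ × ℝ
  arc : Sym2 V → Set (ℝ × ℝ)
  pos_injective : Function.Injective pos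
  isArc : ∀ u v : V, G.Adj u v → IsPolygonalArc (pos u) (pos v) (arc s(u, v))
  vertex_mem : ∀ e ∈ G.edgeSet, ∀ w : V, pos w ∈ arc e → w ∈ e
  inter_subset : ∀ e ∈ G.edgeSet, ∀ f ∈ G.edgeSet, e ≠ f →
    arc e ∩ arc f ⊆ {x | ∃ w : V, w ∈ e ∧ w ∈ f ∧ pos w = x}

/-- A graph is planar if it can be drawn in the plane without crossings. -/
def IsPlanar {V : Type*} (G : SimpleGraph V) : Prop :=
  Nonempty (PlaneDrawing G)

/-! ### Paths, stars and spiders with prescribed degrees -/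

section Configurations

variable {V : Type*} [Fintype V] (G : SimpleGraph V) [DecidableRel G.Adj]

/-- `G` has an `(a₁, …, aₖ)`-path: a path `v₁ ⋯ vₖ` of `G` such that the degree of `vᵢ` in `G`
is `aᵢ`. -/
def HasDegreePath (a : List ℕ) : Prop :=
  ∃ (u v : V) (p : G.Walk u v), p.IsPath ∧ p.support.map (fun x => G.degree x) = a

/-- `G` contains the spider described by `legs`: there is a vertex `w` whose degree in `G` is the
number of legs, with paths of `G` starting at `w`, one for each leg and pairwise disjoint apart
from `w`, such that the degrees in `G` of the vertices following `w` on the `i`-th path belong to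
the sets listed in the `i`-th leg, in this order. In particular every edge at `w` lies on
a leg. -/
def HasSpider (legs : List (List (Set ℕ))) : Prop :=
  ∃ (w : V) (paths : List (List V)),
    G.degree w = legs.length ∧
    (w :: paths.flatten).Nodup ∧
    (∀ l ∈ paths, List.IsChain G.Adj (w :: l)) ∧
    List.Forall₂ (List.Forall₂ (fun (x : V) (S : Set ℕ) => G.degree x ∈ S)) paths legs

/-- `G` has a `(κ; S₁, …, S_κ)`-star: a vertex of degree `κ` whose neighbours have degrees in
`S₁, …, S_κ`. -/
def HasStar (S : List (Set ℕ)) : Prop :=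
  HasSpider G (S.map fun A => [A])

end Configurations

/-- A leg that starts with one `2`-vertex; its other end is unrestricted. -/
def leg1 : List (Set ℕ) := [{2}, Set.univ]

/-- A leg that starts with two `2`-vertices; its other end is unrestricted. -/
def leg2 : List (Set ℕ) := [{2}, {2}, Set.univ]

/-! The twelve pictured configurations; each is a spider whose centre has as many legs as its
degree. -/

def configA : List (List (Set ℕ)) := [leg2, leg1, leg1]
def configB : List (List (Set ℕ)) := [leg2, leg2, [{3}]]
def configC : List (List (Set ℕ)) := [leg2, leg2, leg2, leg1]
def configD : List (List (Set ℕ)) := [leg2, leg2, leg1, leg1]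
def configE : List (List (Set ℕ)) := [leg2, leg2, leg2, [Set.Iic 5]]
def configF : List (List (Set ℕ)) := [leg2, leg1, leg1, leg1]
def configG : List (List (Set ℕ)) := [leg2, leg2, leg1, [Set.Iic 7]]
def configH : List (List (Set ℕ)) := [leg2, leg2, leg2, leg2, leg1]
def configI : List (List (Set ℕ)) := [leg2, leg2, leg2, leg2, [Set.Iic 7]]
def configJ : List (List (Set ℕ)) := [leg2, leg2, leg2, leg1, leg1]
def configK : List (List (Set ℕ)) := [leg2, leg2, leg2, leg2, leg2, leg1]
def configL : List (List (Set ℕ)) := [leg2, leg2, leg2, leg2, leg2, leg2, leg2]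

end LightSubgraph

/-! The proof is a discharging argument on top of an Euler-type inequality, which is extracted from
the drawing without faces or the Jordan curve theorem.

Let Z be the binary cycle space. In the plane, an edge weight in a group of exponent two with zero
sum at every vertex is the jump of a labelling of the sides of the edges: the label of a side is the
sum of the weights lying above it. Moreover, for each label f the edges with f on exactly one side
form an even set (`PlaneDrawing.exists_side_function`). For the universal weight e ↦ (S ↦ S e), with
values in the functions on Z, these even sets B f act as face boundaries: they span Z, and each edge
lies in at most two of them. A basis T chosen among them, if nonempty, gives together with its sum
|T| + 1 nonzero even sets that cover each edge at most twice. Each contains a cycle, so g(|T| + 1) ≤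
2|E|; since |T| ≥ |E| - |V|, this yields g|E| < g|V| + 2|E| (`IsPlanar.mul_card_edges_lt`).

Give v the charge (g - 2)deg(v) - 2g; the total is negative. Without (2,2,2)-paths, a 2-vertex
recovers its deficit 4 from its neighbours of larger degree, and a vertex of degree at least K can
pay 4 to every neighbour once (g - 6)K ≥ 2g. So some vertex of degree between 3 and K - 1 stays
negative (`exists_deficient_vertex`), hence has many neighbours of types 1 and 2 and few of degree
at least K. For (g, K) = (12, 4), (10, 5), (9, 6), (8, 8) each possible degree forces a listed
configuration; girth at least 7 makes its legs disjoint. -/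

namespace LightSubgraph

/-! ### Side labellings for segments that are graphs of affine functions -/

open Filter Topology

/-- Read the indices by decreasing key as segments stacked downwards, U being the label above all of
them: the label below one segment is the label above the next, so modulo two only the top and bottom
labels survive. -/
theorem sum_indicator_telescope {ι W : Type*} [AddCommGroup W] [DecidableEq ι] [DecidableEq W]
    (s : Finset ι) (key : ι → ℝ) (g : ι → W) (U f : W) (hinj : Set.InjOn key s) :
    ∑ i ∈ s, ((if U + ∑ j ∈ s with key i < key j, g j = f then (1 : ZMod 2) else 0) +
        (if U + ∑ j ∈ s with key i < key j, g j + g i = f then 1 else 0)) =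
      (if U = f then 1 else 0) + (if U + ∑ j ∈ s, g j = f then 1 else 0) := by
  induction s using Finset.induction_on_min_value key with
  | empty => simp [CharTwo.add_self_eq_zero]
  | insert a s ha hmin ih =>
    have hs : Set.InjOn key s := hinj.mono (by simp)
    have hlt : ∀ x ∈ s, key a < key x := fun x hx =>
      lt_of_le_of_ne (hmin x hx) fun h => ha (by
        have := hinj (by simp) (by simp [hx]) h
        rwa [this])
    have h1 : ∀ i ∈ s, (insert a s).filter (fun j => key i < key j) =
        s.filter (fun j => key i < key j) := fun i hi => by
      rw [Finset.filter_insert, if_neg (hlt i hi).le.not_gt]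
    have h2 : (insert a s).filter (fun j => key a < key j) = s := by
      rw [Finset.filter_insert, if_neg (lt_irrefl _), Finset.filter_true_of_mem hlt]
    have h3 := ih hs
    rw [Finset.sum_congr rfl fun i hi => by rw [← h1 i hi]] at h3
    rw [Finset.sum_insert ha, h2, h3, Finset.sum_insert ha, ← add_assoc, add_right_comm U, add_assoc U]
    generalize (if U + ∑ x ∈ s, g x = f then (1 : ZMod 2) else 0) = p
    rw [← add_assoc U, add_right_comm U]
    generalize (if U + g a + ∑ x ∈ s, g x = f then (1 : ZMod 2) else 0) = q
    generalize (if U = f then (1 : ZMod 2) else 0) = r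
    have := CharTwo.add_self_eq_zero p
    linear_combination this

/-- Segments in the plane, given as pieces of graphs of affine functions, that meet only in
common ends: a weight `g` in a group of exponent two whose sum at each end vanishes is the jump
of a function defined on the sides of the segments. -/
theorem exists_side_function_of_graphs {ι W : Type*} [Fintype ι] [AddCommGroup W] [DecidableEq W]
    (hW : ∀ w : W, w + w = 0) (xa xb m c : ι → ℝ) (hlt : ∀ i, xa i < xb i)
    (hend : ∀ i j x, (xa i = x ∨ xb i = x) → (xa j = x ∨ xb j = x) →
      m i * x + c i = m j * x + c j)
    (hmeet : ∀ i j x, i ≠ j → xa i ≤ x → x ≤ xb i → xa j ≤ x → x ≤ xb j →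
      m i * x + c i = m j * x + c j → (xa i = x ∨ xb i = x) ∧ (xa j = x ∨ xb j = x))
    (g : ι → W) (hg : ∀ x, ∑ i with (xa i = x ∨ xb i = x), g i = 0) :
    ∃ up : ι → W, ∀ x f, ∑ i with (xa i = x ∨ xb i = x),
      ((if up i = f then (1 : ZMod 2) else 0) + (if up i + g i = f then 1 else 0)) = 0 := by
  classical
  -- `A i x` is the total weight strictly above segment i at abscissa x. `Ar` and `Al` are its
  -- one-sided limits: for segments through the same point, the slopes decide which is above just
  -- after or just before x.
  set A : ι → ℝ → W := fun i x =>
    ∑ j with (xa j ≤ x ∧ x < xb j ∧ m i * x + c i < m j * x + c j), g j with hA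
  set Ar : ι → ℝ → W := fun i x => ∑ j with (xa j ≤ x ∧ x < xb j ∧
    (m i * x + c i < m j * x + c j ∨ m i * x + c i = m j * x + c j ∧ m i < m j)), g j with hAr
  set Al : ι → ℝ → W := fun i x => ∑ j with (xa j < x ∧ x ≤ xb j ∧
    (m i * x + c i < m j * x + c j ∨ m i * x + c i = m j * x + c j ∧ m j < m i)), g j with hAl
  have hcont : ∀ i, Continuous fun x => m i * x + c i := fun i => by fun_prop
  have hright : ∀ i x, ∀ᶠ z in 𝓝[>] x, A i z = Ar i x := by
    intro i x
    have key : ∀ j, ∀ᶠ z in 𝓝[>] x,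
        ((xa j ≤ z ∧ z < xb j ∧ m i * z + c i < m j * z + c j) ↔ (xa j ≤ x ∧ x < xb j ∧
          (m i * x + c i < m j * x + c j ∨ m i * x + c i = m j * x + c j ∧ m i < m j))) := by
      intro j
      have e0 : ∀ᶠ z in 𝓝[>] x, x < z := self_mem_nhdsWithin
      have e1 : ∀ᶠ z in 𝓝[>] x, (xa j ≤ z ↔ xa j ≤ x) := by
        rcases le_or_gt (xa j) x with h | h
        · filter_upwards [e0] with z hz
          exact ⟨fun _ => h, fun _ => h.trans hz.le⟩
        · filter_upwards [nhdsWithin_le_nhds (eventually_lt_nhds h)] with z hz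
          exact ⟨fun h' => absurd hz h'.not_gt, fun h' => absurd h h'.not_gt⟩
      have e2 : ∀ᶠ z in 𝓝[>] x, (z < xb j ↔ x < xb j) := by
        rcases lt_or_ge x (xb j) with h | h
        · filter_upwards [nhdsWithin_le_nhds (eventually_lt_nhds h)] with z hz
          exact ⟨fun _ => h, fun _ => hz⟩
        · filter_upwards [e0] with z hz
          exact ⟨fun h' => hz.trans h', fun h' => absurd h' h.not_gt⟩
      have e3 : ∀ᶠ z in 𝓝[>] x, (m i * z + c i < m j * z + c j ↔
          (m i * x + c i < m j * x + c j ∨ m i * x + c i = m j * x + c j ∧ m i < m j)) := by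
        rcases lt_trichotomy (m i * x + c i) (m j * x + c j) with h | h | h
        · filter_upwards [nhdsWithin_le_nhds
            ((hcont i).continuousAt.eventually_lt (hcont j).continuousAt h)] with z hz
          exact ⟨fun _ => Or.inl h, fun _ => hz⟩
        · filter_upwards [e0] with z hz
          constructor
          · intro h'; right; refine ⟨h, ?_⟩; nlinarith
          · rintro (h' | ⟨-, h'⟩)
            · exact absurd h h'.ne
            · nlinarith
        · filter_upwards [nhdsWithin_le_nhds
            ((hcont j).continuousAt.eventually_lt (hcont i).continuousAt h)] with z hz
          constructor
          · intro h'; exact absurd h' hz.not_gt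
          · rintro (h' | ⟨h', -⟩)
            · exact absurd h h'.not_gt
            · exact absurd h' h.ne'
      filter_upwards [e1, e2, e3] with z h1 h2 h3
      rw [h1, h2, h3]
    filter_upwards [eventually_all.2 key] with z hz
    simp only [hA, hAr, hz]
  have hleft : ∀ i x, ∀ᶠ z in 𝓝[<] x, A i z = Al i x := by
    intro i x
    have key : ∀ j, ∀ᶠ z in 𝓝[<] x,
        ((xa j ≤ z ∧ z < xb j ∧ m i * z + c i < m j * z + c j) ↔ (xa j < x ∧ x ≤ xb j ∧
          (m i * x + c i < m j * x + c j ∨ m i * x + c i = m j * x + c j ∧ m j < m i))) := by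
      intro j
      have e0 : ∀ᶠ z in 𝓝[<] x, z < x := self_mem_nhdsWithin
      have e1 : ∀ᶠ z in 𝓝[<] x, (xa j ≤ z ↔ xa j < x) := by
        rcases lt_or_ge (xa j) x with h | h
        · filter_upwards [nhdsWithin_le_nhds (eventually_gt_nhds h)] with z hz
          exact ⟨fun _ => h, fun _ => hz.le⟩
        · filter_upwards [e0] with z hz
          exact ⟨fun h' => h'.trans_lt hz, fun h' => absurd h' h.not_gt⟩
      have e2 : ∀ᶠ z in 𝓝[<] x, (z < xb j ↔ x ≤ xb j) := by
        rcases le_or_gt x (xb j) with h | h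
        · filter_upwards [e0] with z hz
          exact ⟨fun _ => h, fun _ => hz.trans_le h⟩
        · filter_upwards [nhdsWithin_le_nhds (eventually_gt_nhds h)] with z hz
          exact ⟨fun h' => absurd hz h'.not_gt, fun h' => absurd h h'.not_gt⟩
      have e3 : ∀ᶠ z in 𝓝[<] x, (m i * z + c i < m j * z + c j ↔
          (m i * x + c i < m j * x + c j ∨ m i * x + c i = m j * x + c j ∧ m j < m i)) := by
        rcases lt_trichotomy (m i * x + c i) (m j * x + c j) with h | h | h
        · filter_upwards [nhdsWithin_le_nhds
            ((hcont i).continuousAt.eventually_lt (hcont j).continuousAt h)] with z hz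
          exact ⟨fun _ => Or.inl h, fun _ => hz⟩
        · filter_upwards [e0] with z hz
          constructor
          · intro h'; right; refine ⟨h, ?_⟩; nlinarith
          · rintro (h' | ⟨-, h'⟩)
            · exact absurd h h'.ne
            · nlinarith
        · filter_upwards [nhdsWithin_le_nhds
            ((hcont j).continuousAt.eventually_lt (hcont i).continuousAt h)] with z hz
          constructor
          · intro h'; exact absurd h' hz.not_gt
          · rintro (h' | ⟨h', -⟩)
            · exact absurd h h'.not_gt
            · exact absurd h' h.ne'
      filter_upwards [e1, e2, e3] with z h1 h2 h3
      rw [h1, h2, h3]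
    filter_upwards [eventually_all.2 key] with z hz
    simp only [hA, hAl, hz]
  have hne : ∀ i j x, xa i < x → x < xb i → i ≠ j → xa j ≤ x → x ≤ xb j →
      m i * x + c i ≠ m j * x + c j := fun i j x h1 h2 hij h3 h4 h5 => by
    rcases (hmeet i j x hij h1.le h2.le h3 h4 h5).1 with h | h
    · exact h1.ne h
    · exact h2.ne' h
  have hAr_eq : ∀ i x, xa i < x → x < xb i → A i x = Ar i x := by
    intro i x h1 h2
    simp only [hA, hAr]
    congr 1
    ext j
    simp only [Finset.mem_filter, Finset.mem_univ, true_and]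
    constructor
    · rintro ⟨p, q, r⟩; exact ⟨p, q, Or.inl r⟩
    · rintro ⟨p, q, r | ⟨r, s⟩⟩
      · exact ⟨p, q, r⟩
      · have hij : i ≠ j := by rintro rfl; exact lt_irrefl _ s
        exact absurd r (hne i j x h1 h2 hij p q.le)
  have hAl_eq : ∀ i x, xa i < x → x < xb i → A i x = Al i x := by
    intro i x h1 h2
    have hAl' : Al i x =
        ∑ j with (xa j < x ∧ x ≤ xb j ∧ m i * x + c i < m j * x + c j), g j := by
      simp only [hAl]
      congr 1
      ext j
      simp only [Finset.mem_filter, Finset.mem_univ, true_and]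
      constructor
      · rintro ⟨p, q, r | ⟨r, s⟩⟩
        · exact ⟨p, q, r⟩
        · have hij : i ≠ j := by rintro rfl; exact lt_irrefl _ s
          exact absurd r (hne i j x h1 h2 hij p.le q)
      · rintro ⟨p, q, r⟩; exact ⟨p, q, Or.inl r⟩
    -- A segment passing over x is counted twice and cancels. What remains are the segments with an
    -- end at x; these ends are one common point, so all or none of them lie above i, and their
    -- weights sum to zero.
    have hsum : A i x + Al i x =
        ∑ j with (xa j = x ∨ xb j = x), if m i * x + c i < m j * x + c j then g j else 0 := by
      rw [hAl']
      simp only [hA, Finset.sum_filter, ← Finset.sum_add_distrib]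
      refine Finset.sum_congr rfl fun j _ => ?_
      have := hlt j
      by_cases h3 : m i * x + c i < m j * x + c j
      · by_cases ha : xa j = x
        · subst ha
          rw [if_pos ⟨le_rfl, this, h3⟩, if_neg fun h => lt_irrefl _ h.1, if_pos (Or.inl rfl),
            if_pos h3, add_zero]
        · by_cases hb : xb j = x
          · have : xa j < x := hb ▸ this
            simp [hb, this]
          · have e1 : xa j ≤ x ↔ xa j < x := ⟨fun h => lt_of_le_of_ne h ha, le_of_lt⟩
            have e2 : x ≤ xb j ↔ x < xb j := ⟨fun h => lt_of_le_of_ne h (Ne.symm hb), le_of_lt⟩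
            simp only [ha, hb, e1, e2, or_self, if_false]
            split_ifs <;> simp [hW]
      · simp [h3]
    have hz : A i x + Al i x = 0 := by
      rw [hsum]
      by_cases hex : ∃ j, (xa j = x ∨ xb j = x) ∧ m i * x + c i < m j * x + c j
      · obtain ⟨j0, hj0, hlt0⟩ := hex
        rw [← hg x]
        refine Finset.sum_congr rfl fun j hj => ?_
        rw [if_pos]
        rw [hend j j0 x (by simpa using hj) hj0]
        exact hlt0
      · push Not at hex
        refine Finset.sum_eq_zero fun j hj => if_neg ?_
        exact (hex j (by simpa using hj)).not_gt
    have := hW (Al i x)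
    rw [← hz] at this
    exact (add_right_cancel this).symm
  set up : ι → W := fun i => A i ((xa i + xb i) / 2) with hup
  have hconst : ∀ i x, xa i < x → x < xb i → A i x = up i := by
    intro i x h1 h2
    -- With the discrete topology, local constancy is continuity, and an interval is connected.
    let : TopologicalSpace W := ⊥
    have : DiscreteTopology W := ⟨rfl⟩
    have hc : ContinuousOn (A i) (Set.Ioo (xa i) (xb i)) := by
      intro z hz
      apply ContinuousAt.continuousWithinAt
      rw [continuousAt_iff_continuous_left'_right']
      constructor
      · refine tendsto_nhds_of_eventually_eq ?_
        filter_upwards [hleft i z] with t ht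
        rw [ht, hAl_eq i z hz.1 hz.2]
      · refine tendsto_nhds_of_eventually_eq ?_
        filter_upwards [hright i z] with t ht
        rw [ht, hAr_eq i z hz.1 hz.2]
    have := hlt i
    exact isPreconnected_Ioo.constant hc ⟨h1, h2⟩ ⟨by linarith, by linarith⟩
  have hup_r : ∀ i, up i = Ar i (xa i) := by
    intro i
    obtain ⟨z, hz, h1, h2⟩ := ((hright i (xa i)).and (Ioo_mem_nhdsGT (hlt i))).exists
    rw [← hz, hconst i z h1 h2]
  have hup_l : ∀ i, up i = Al i (xb i) := by
    intro i
    obtain ⟨z, hz, h1, h2⟩ := ((hleft i (xb i)).and (Ioo_mem_nhdsLT (hlt i))).exists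
    rw [← hz, hconst i z h1 h2]
  refine ⟨up, fun x f => ?_⟩
  by_cases hex : ∃ i, xa i = x ∨ xb i = x
  swap
  · exact Finset.sum_eq_zero fun i hi => absurd ⟨i, (Finset.mem_filter.1 hi).2⟩ hex
  obtain ⟨i0, hi0⟩ := hex
  set Y := m i0 * x + c i0 with hY
  -- `U` is the weight passing above the common end point. Going down the right-hand segments `R`
  -- and down the left-hand ones `L` starts from the same label `U`, and ends at the same label
  -- because the weights at the point sum to zero.
  set U : W := ∑ j with (xa j < x ∧ x < xb j ∧ Y < m j * x + c j), g j with hU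
  set R : Finset ι := Finset.univ.filter fun j => xa j = x with hR
  set L : Finset ι := Finset.univ.filter fun j => xb j = x with hL
  have hY_eq : ∀ i, (xa i = x ∨ xb i = x) → m i * x + c i = Y := fun i hi => hend i i0 x hi hi0
  have hYne : ∀ j, xa j < x → x < xb j → Y ≠ m j * x + c j := by
    intro j h1 h2 h3
    have hij : j ≠ i0 := by
      rintro rfl
      rcases hi0 with h | h
      · exact h1.ne h
      · exact h2.ne' h
    have hi1 : xa i0 ≤ x ∧ x ≤ xb i0 := by
      have := hlt i0
      rcases hi0 with h | h <;> constructor <;> linarith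
    exact hne j i0 x h1 h2 hij hi1.1 hi1.2 h3.symm
  have hRup : ∀ i ∈ R, up i = U + ∑ j ∈ R with m i < m j, g j := by
    intro i hi
    have hi' : xa i = x := by simpa [hR] using hi
    rw [hup_r i, hi', hU, hR, Finset.filter_filter]
    simp only [hAr, hY_eq i (Or.inl hi'), Finset.sum_filter, ← Finset.sum_add_distrib]
    refine Finset.sum_congr rfl fun j _ => ?_
    have := hlt j
    by_cases ha : xa j = x
    · have hy := hY_eq j (Or.inl ha)
      have : x < xb j := ha ▸ this
      simp [ha, hy, this]
    · have e1 : xa j ≤ x ↔ xa j < x := ⟨fun h => lt_of_le_of_ne h ha, le_of_lt⟩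
      simp only [ha, e1, false_and, if_false, add_zero]
      congr 1
      simp only [eq_iff_iff]
      constructor
      · rintro ⟨p, q, r | ⟨r, s⟩⟩
        · exact ⟨p, q, r⟩
        · exact absurd r (hYne j p q)
      · rintro ⟨p, q, r⟩; exact ⟨p, q, Or.inl r⟩
  have hLup : ∀ i ∈ L, up i = U + ∑ j ∈ L with - m i < - m j, g j := by
    intro i hi
    have hi' : xb i = x := by simpa [hL] using hi
    rw [hup_l i, hi', hU, hL, Finset.filter_filter]
    simp only [hAl, hY_eq i (Or.inr hi'), Finset.sum_filter, ← Finset.sum_add_distrib, neg_lt_neg_iff]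
    refine Finset.sum_congr rfl fun j _ => ?_
    have := hlt j
    by_cases hb : xb j = x
    · have hy := hY_eq j (Or.inr hb)
      have : xa j < x := hb ▸ this
      simp [hb, hy, this]
    · have e1 : x ≤ xb j ↔ x < xb j := ⟨fun h => lt_of_le_of_ne h (Ne.symm hb), le_of_lt⟩
      simp only [hb, e1, false_and, if_false, add_zero]
      congr 1
      simp only [eq_iff_iff]
      constructor
      · rintro ⟨p, q, r | ⟨r, s⟩⟩
        · exact ⟨p, q, r⟩
        · exact absurd r (hYne j p q)
      · rintro ⟨p, q, r⟩; exact ⟨p, q, Or.inl r⟩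
  -- Two segments leaving a point on the same side with equal slope would overlap.
  have hinjR : Set.InjOn m R := by
    intro i hi j hj hm
    by_contra hij
    have hi' : xa i = x := by simpa [hR] using hi
    have hj' : xa j = x := by simpa [hR] using hj
    obtain ⟨z, hz1, hz2⟩ := exists_between (lt_min (hi' ▸ hlt i) (hj' ▸ hlt j))
    have h1 := lt_min_iff.1 hz2
    refine hne i j z (hi' ▸ hz1) h1.1 hij (hj' ▸ hz1.le) h1.2.le ?_
    have := hend i j x (Or.inl hi') (Or.inl hj')
    rw [hm] at this ⊢
    linarith
  have hinjL : Set.InjOn (fun i => - m i) L := by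
    intro i hi j hj hm
    by_contra hij
    have hi' : xb i = x := by simpa [hL] using hi
    have hj' : xb j = x := by simpa [hL] using hj
    obtain ⟨z, hz1, hz2⟩ := exists_between (max_lt (hi' ▸ hlt i) (hj' ▸ hlt j))
    have h1 := max_lt_iff.1 hz1
    refine hne i j z h1.1 (hi' ▸ hz2) hij h1.2.le (hj' ▸ hz2.le) ?_
    have := hend i j x (Or.inr hi') (Or.inr hj')
    have hm' : m i = m j := neg_injective hm
    rw [hm'] at this ⊢
    linarith
  have hdisj : Disjoint R L := by
    rw [Finset.disjoint_left]
    intro i hi hi2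
    have h1 : xa i = x := by simpa [hR] using hi
    have h2 : xb i = x := by simpa [hL] using hi2
    have := hlt i
    linarith
  have hRL : (Finset.univ.filter fun i => xa i = x ∨ xb i = x) = R ∪ L := by
    rw [Finset.filter_or]
  have hgx := hg x
  rw [hRL, Finset.sum_union hdisj] at hgx ⊢
  rw [Finset.sum_congr rfl fun i hi => by rw [hRup i hi],
    Finset.sum_congr (s₁ := L) rfl fun i hi => by rw [hLup i hi],
    sum_indicator_telescope R m g U f hinjR, sum_indicator_telescope L (fun i => - m i) g U f hinjL]
  have hRL' : ∑ j ∈ R, g j = ∑ j ∈ L, g j := by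
    rw [← hW (∑ j ∈ L, g j)] at hgx
    exact add_right_cancel hgx
  rw [hRL']
  exact CharTwo.add_self_eq_zero _

/-! ### Arbitrary segments, by shearing -/

/-- Two distinct points get the same abscissa for at most one t, so only finitely many t are bad.
Such a shear removes vertical segments and lets an abscissa identify an end point. -/
theorem exists_shear_injOn (s : Finset (ℝ × ℝ)) :
    ∃ t : ℝ, Set.InjOn (fun p : ℝ × ℝ => p.1 + t * p.2) s := by
  classical
  obtain ⟨t, ht⟩ := Set.Infinite.exists_notMem_finset (Set.infinite_univ (α := ℝ))
    ((s ×ˢ s).image fun q => (q.2.1 - q.1.1) / (q.1.2 - q.2.2))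
  refine ⟨t, fun p hp q hq hpq => ?_⟩
  simp only at hpq
  by_cases h : p.2 = q.2
  · rw [h] at hpq
    exact Prod.ext (by linarith) h
  · refine absurd ?_ ht.2
    refine Finset.mem_image.2 ⟨(p, q), Finset.mem_product.2 ⟨hp, hq⟩, ?_⟩
    rw [div_eq_iff (sub_ne_zero.2 h)]
    linarith

/-- A point of the line through `p` and `q`, in sheared coordinates, lies on the segment. -/
theorem mem_segment_of_shear {p q : ℝ × ℝ} {t x : ℝ}
    (hpq : p.1 + t * p.2 < q.1 + t * q.2) (h1 : p.1 + t * p.2 ≤ x) (h2 : x ≤ q.1 + t * q.2)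
    (y : ℝ) (hy : y = (q.2 - p.2) / (q.1 + t * q.2 - (p.1 + t * p.2)) * x +
      (p.2 - (q.2 - p.2) / (q.1 + t * q.2 - (p.1 + t * p.2)) * (p.1 + t * p.2))) :
    (x - t * y, y) ∈ segment ℝ p q := by
  have hd : 0 < q.1 + t * q.2 - (p.1 + t * p.2) := by linarith
  rw [segment_eq_image]
  refine ⟨(x - (p.1 + t * p.2)) / (q.1 + t * q.2 - (p.1 + t * p.2)),
    ⟨div_nonneg (by linarith) hd.le, (div_le_one hd).2 (by linarith)⟩, ?_⟩
  set D := q.1 + t * q.2 - (p.1 + t * p.2) with hD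
  have hy' : y = p.2 + (x - (p.1 + t * p.2)) / D * (q.2 - p.2) := by
    rw [hy]; field_simp; ring
  have hx' : x = p.1 + t * p.2 + (x - (p.1 + t * p.2)) / D * D := by
    field_simp; ring
  set r := (x - (p.1 + t * p.2)) / D with hr
  ext
  · simp only [Prod.fst_add, Prod.smul_fst, smul_eq_mul]
    rw [hy']
    linear_combination -hx' + r * hD
  · simp only [Prod.snd_add, Prod.smul_snd, smul_eq_mul]
    rw [hy']
    ring

/-- Segments in the plane that meet only in common ends: a weight `g` in a group of exponent two
whose sum at each end vanishes is the jump of a function defined on the sides of the segments. -/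
theorem exists_side_function_of_segments {ι W : Type*} [Fintype ι] [AddCommGroup W]
    [DecidableEq W] (hW : ∀ w : W, w + w = 0) (a b : ι → ℝ × ℝ) (hab : ∀ i, a i ≠ b i)
    (hmeet : ∀ i j p, i ≠ j → p ∈ segment ℝ (a i) (b i) → p ∈ segment ℝ (a j) (b j) →
      (a i = p ∨ b i = p) ∧ (a j = p ∨ b j = p))
    (g : ι → W) (hg : ∀ p, ∑ i with (a i = p ∨ b i = p), g i = 0) :
    ∃ up : ι → W, ∀ p f, ∑ i with (a i = p ∨ b i = p),
      ((if up i = f then (1 : ZMod 2) else 0) + (if up i + g i = f then 1 else 0)) = 0 := by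
  classical
  obtain ⟨t, ht⟩ := exists_shear_injOn (Finset.univ.image a ∪ Finset.univ.image b)
  set X : ℝ × ℝ → ℝ := fun p => p.1 + t * p.2 with hX
  have hinj : ∀ i j p q, (a i = p ∨ b i = p) → (a j = q ∨ b j = q) → X p = X q → p = q := by
    have hmem : ∀ i p, (a i = p ∨ b i = p) →
        p ∈ ((Finset.univ.image a ∪ Finset.univ.image b : Finset (ℝ × ℝ)) : Set (ℝ × ℝ)) := by
      rintro i p (rfl | rfl) <;> simp
    exact fun i j p q hp hq h => ht (hmem i p hp) (hmem j q hq) h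
  have hor : ∀ i, ∃ l r : ℝ × ℝ, X l < X r ∧ segment ℝ l r = segment ℝ (a i) (b i) ∧
      ∀ p, (a i = p ∨ b i = p) ↔ (l = p ∨ r = p) := by
    intro i
    rcases lt_trichotomy (X (a i)) (X (b i)) with h | h | h
    · exact ⟨a i, b i, h, rfl, fun p => Iff.rfl⟩
    · exact absurd (hinj i i _ _ (Or.inl rfl) (Or.inr rfl) h) (hab i)
    · exact ⟨b i, a i, h, segment_symm _ _ _, fun p => or_comm⟩
  choose l r hlr hseg hends using hor
  have hl : ∀ i, a i = l i ∨ b i = l i := fun i => (hends i _).2 (Or.inl rfl)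
  have hr : ∀ i, a i = r i ∨ b i = r i := fun i => (hends i _).2 (Or.inr rfl)
  have hpt : ∀ i x, (X (l i) = x ∨ X (r i) = x) →
      ∃ p, X p = x ∧ (a i = p ∨ b i = p) ∧
        p.2 = ((r i).2 - (l i).2) / (X (r i) - X (l i)) * x +
          ((l i).2 - ((r i).2 - (l i).2) / (X (r i) - X (l i)) * X (l i)) := by
    intro i x h
    have := hlr i
    have hd : X (r i) - X (l i) ≠ 0 := by linarith
    rcases h with h | h
    · exact ⟨l i, h, hl i, by rw [← h]; ring⟩
    · refine ⟨r i, h, hr i, ?_⟩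
      rw [← h]
      linear_combination -(div_mul_cancel₀ ((r i).2 - (l i).2) hd)
  have hptX : ∀ i p, (a i = p ∨ b i = p) → (X (l i) = X p ∨ X (r i) = X p) := by
    intro i p h
    rcases (hends i p).1 h with rfl | rfl
    · exact Or.inl rfl
    · exact Or.inr rfl
  have hiff : ∀ i j p, (a j = p ∨ b j = p) →
      ((X (l i) = X p ∨ X (r i) = X p) ↔ (a i = p ∨ b i = p)) := by
    intro i j p hp
    refine ⟨?_, hptX i p⟩
    rintro (h | h)
    · rw [← hinj i j _ _ (hl i) hp h]; exact hl i
    · rw [← hinj i j _ _ (hr i) hp h]; exact hr i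
  obtain ⟨up, hup⟩ := exists_side_function_of_graphs hW (fun i => X (l i)) (fun i => X (r i))
    (fun i => ((r i).2 - (l i).2) / (X (r i) - X (l i)))
    (fun i => (l i).2 - ((r i).2 - (l i).2) / (X (r i) - X (l i)) * X (l i)) hlr
    (by
      intro i j x hi hj
      obtain ⟨p, hp, hp1, hp2⟩ := hpt i x hi
      obtain ⟨q, hq, hq1, hq2⟩ := hpt j x hj
      have := hinj i j p q hp1 hq1 (hp.trans hq.symm)
      rw [← hp2, ← hq2, this])
    (by
      intro i j x hij h1 h2 h3 h4 h5
      have e1 := mem_segment_of_shear (hlr i) h1 h2 _ rfl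
      have e2 := mem_segment_of_shear (hlr j) h3 h4 _ rfl
      simp only [hX] at h5
      rw [← h5, hseg] at e2
      rw [hseg] at e1
      have e3 := hmeet i j _ hij e1 e2
      have hXp : ∀ y, X (x - t * y, y) = x := fun y => by simp [hX]
      have k1 := hptX i _ e3.1
      have k2 := hptX j _ e3.2
      rw [hXp] at k1 k2
      exact ⟨k1, k2⟩)
    g
    (by
      intro x
      by_cases hex : ∃ i, X (l i) = x ∨ X (r i) = x
      · obtain ⟨i, hi⟩ := hex
        obtain ⟨p, rfl, hp, -⟩ := hpt i x hi
        simp only [hiff _ i p hp]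
        exact hg p
      · exact Finset.sum_eq_zero fun i hi => absurd ⟨i, (Finset.mem_filter.1 hi).2⟩ hex)
  refine ⟨up, fun p f => ?_⟩
  by_cases hex : ∃ i, a i = p ∨ b i = p
  · obtain ⟨i, hi⟩ := hex
    have := hup (X p) f
    simp only [hiff _ i p hi] at this
    exact this
  · exact Finset.sum_eq_zero fun i hi => absurd ⟨i, (Finset.mem_filter.1 hi).2⟩ hex

/-! ### From broken lines to plane drawings -/

theorem segment_subset_polyline (l : List (ℝ × ℝ)) (k : ℕ) (hk : k + 1 < l.length) :
    segment ℝ (l.getD k 0) (l.getD (k + 1) 0) ⊆ polyline l := by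
  induction l generalizing k with
  | nil => simp at hk
  | cons p l ih =>
    cases l with
    | nil => simp at hk
    | cons q l =>
      cases k with
      | zero => simp [polyline]
      | succ k =>
        have := ih k (by simpa using hk)
        simp only [List.getD_cons_succ] at this ⊢
        exact this.trans Set.subset_union_right

theorem IsSimplePolyline.ne_succ {l : List (ℝ × ℝ)} (hl : IsSimplePolyline l) (k : ℕ)
    (hk : k + 1 < l.length) : l.getD k 0 ≠ l.getD (k + 1) 0 := by
  induction l generalizing k with
  | nil => simp at hk
  | cons p l ih =>
    cases l with
    | nil => simp at hk
    | cons q l =>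
      obtain ⟨h1, -, h3⟩ := hl
      cases k with
      | zero => simpa using h1
      | succ k =>
        have := ih h3 k (by simpa using hk)
        simpa only [List.getD_cons_succ] using this

theorem IsSimplePolyline.eq_of_mem_segments {l : List (ℝ × ℝ)} (hl : IsSimplePolyline l)
    {i j : ℕ} (hij : i < j) (hj : j + 1 < l.length) {x : ℝ × ℝ}
    (hi : x ∈ segment ℝ (l.getD i 0) (l.getD (i + 1) 0))
    (hx : x ∈ segment ℝ (l.getD j 0) (l.getD (j + 1) 0)) : j = i + 1 ∧ x = l.getD j 0 := by
  induction l generalizing i j x with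
  | nil => simp at hj
  | cons p l ih =>
    cases l with
    | nil => simp at hj
    | cons q l =>
      obtain ⟨-, h2, h3⟩ := hl
      obtain ⟨j, rfl⟩ : ∃ j', j = j' + 1 := ⟨j - 1, by omega⟩
      have hj' : j + 1 < (q :: l).length := by simpa using hj
      simp only [List.getD_cons_succ] at hx ⊢
      cases i with
      | succ i =>
        simp only [List.getD_cons_succ] at hi
        obtain ⟨e1, e2⟩ := ih h3 (by omega : i < j) hj' hi hx
        exact ⟨by omega, e2⟩
      | zero =>
        have hxq : x = q := by
          have : x ∈ segment ℝ p q ∩ polyline (q :: l) :=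
            ⟨by simpa using hi, segment_subset_polyline _ j hj' hx⟩
          rw [h2] at this
          exact this
        subst hxq
        rcases Nat.eq_zero_or_pos j with rfl | hpos
        · simp
        -- The point x would be both the start and the end of the first segment of the tail, which
        -- is nondegenerate.
        · exfalso
          have hx0 : x ∈ segment ℝ ((x :: l).getD 0 0) ((x :: l).getD (0 + 1) 0) := by
            simpa using left_mem_segment ℝ _ _
          obtain ⟨rfl, e2⟩ := ih h3 hpos hj' hx0 hx
          exact h3.ne_succ 0 (by omega) (by simpa using e2)

/-- Every inner visit to p is counted by the two consecutive segments that meet there. -/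
theorem sum_ends_telescope (P : ℕ → ℝ × ℝ) (n : ℕ) (hP : ∀ k < n, P k ≠ P (k + 1))
    {W : Type*} [AddCommGroup W] (hW : ∀ w : W, w + w = 0) (p : ℝ × ℝ) (w : W) :
    ∑ k ∈ Finset.range n, (if P k = p ∨ P (k + 1) = p then w else 0) =
      (if P 0 = p then w else 0) + (if P n = p then w else 0) := by
  induction n with
  | zero => simp only [Finset.range_zero, Finset.sum_empty]; split_ifs <;> simp [hW]
  | succ n ih =>
    rw [Finset.sum_range_succ, ih fun k hk => hP k (by omega), add_assoc]
    congr 1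
    have := hP n (by omega)
    by_cases h1 : P n = p
    · have h2 : P (n + 1) ≠ p := fun h => this (h1.trans h.symm)
      simp [h1, h2, hW]
    · simp [h1]

theorem sum_sigma_ends {E M : Type*} [Fintype E] [AddCommGroup M] (hM : ∀ w : M, w + w = 0)
    (n : E → ℕ) (P : E → ℕ → ℝ × ℝ) (hP : ∀ e, ∀ k < n e, P e k ≠ P e (k + 1)) (β : E → M)
    (p : ℝ × ℝ) :
    ∑ i : (Σ e, Fin (n e)) with (P i.1 i.2 = p ∨ P i.1 (i.2 + 1) = p), β i.1 =
      ∑ e, ((if P e 0 = p then β e else 0) + (if P e (n e) = p then β e else 0)) := by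
  rw [Finset.sum_filter, Fintype.sum_sigma]
  refine Finset.sum_congr rfl fun e _ => ?_
  have := sum_ends_telescope (P e) (n e) (hP e) hM p (β e)
  rwa [Finset.sum_range] at this

theorem sum_ite_ends_eq_sum_mem {V E M : Type*} [Fintype E] [DecidableEq V] [AddCommGroup M]
    {pos : V → ℝ × ℝ} (hpos : Function.Injective pos) {s t : E → V} (hst : ∀ e, s e ≠ t e)
    (β : E → M) (v : V) :
    ∑ e, ((if pos (s e) = pos v then β e else 0) + (if pos (t e) = pos v then β e else 0)) =
      ∑ e with v ∈ s(s e, t e), β e := by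
  rw [Finset.sum_filter]
  refine Finset.sum_congr rfl fun e _ => ?_
  have := hst e
  simp only [hpos.eq_iff, Sym2.mem_iff]
  by_cases h1 : s e = v
  · have h2 : t e ≠ v := fun h => this (h1.trans h.symm)
    simp [h1, h2]
  · by_cases h2 : t e = v
    · simp [h1, h2]
    · simp [h1, h2, Ne.symm h1, Ne.symm h2]

/-- In a plane drawing, a weight on the edges with values in a group of exponent two whose sum at
each vertex vanishes is the jump of a function defined on the sides of the edges; the sides on
which that function takes a given value alternate around each vertex. -/
theorem PlaneDrawing.exists_side_function {V W : Type*} [Fintype V] {G : SimpleGraph V}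
    [Fintype G.edgeSet] (D : PlaneDrawing G) [DecidableEq V] [AddCommGroup W] [DecidableEq W]
    (hW : ∀ w : W, w + w = 0) (γ : G.edgeSet → W)
    (hγ : ∀ v, ∑ e with v ∈ e.1, γ e = 0) :
    ∃ up : G.edgeSet → W, ∀ v f, ∑ e with v ∈ e.1,
      ((if up e = f then (1 : ZMod 2) else 0) + (if up e + γ e = f then 1 else 0)) = 0 := by
  classical
  have hlist : ∀ e : G.edgeSet, ∃ (n : ℕ) (P : ℕ → ℝ × ℝ) (u v : V), u ≠ v ∧ e.1 = s(u, v) ∧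
      0 < n ∧ P 0 = D.pos u ∧ P n = D.pos v ∧ (∀ k < n, P k ≠ P (k + 1)) ∧
      (∀ k < n, segment ℝ (P k) (P (k + 1)) ⊆ D.arc e.1) ∧
      (∀ i j x, i < j → j < n → x ∈ segment ℝ (P i) (P (i + 1)) →
        x ∈ segment ℝ (P j) (P (j + 1)) → j = i + 1 ∧ x = P j) := by
    rintro ⟨e, he⟩
    induction e using Sym2.ind with
    | _ u v =>
      have huv : G.Adj u v := he
      obtain ⟨l, h1, h2, h3, h4⟩ := D.isArc u v huv
      have hne : l ≠ [] := by rintro rfl; simp at h1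
      have hlen : 0 < l.length := List.length_pos_iff.2 hne
      have e0 : l.getD 0 0 = D.pos u := by
        rw [List.head?_eq_getElem?] at h1
        simp [List.getD, h1]
      have e1 : l.getD (l.length - 1) 0 = D.pos v := by
        rw [List.getLast?_eq_getElem?] at h2
        simp [List.getD, h2]
      -- Only indices up to `l.length - 1` matter, so the default value 0 of `getD` is never used.
      refine ⟨l.length - 1, fun k => l.getD k 0, u, v, huv.ne, rfl, ?_, e0, e1,
        fun k hk => h3.ne_succ k (by omega), fun k hk => ?_,
        fun i j x hij hj => h3.eq_of_mem_segments hij (by omega)⟩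
      · rcases Nat.eq_zero_or_pos (l.length - 1) with h | h
        · rw [h, e0] at e1
          exact absurd (D.pos_injective e1) huv.ne
        · exact h
      · rw [← h4]
        exact segment_subset_polyline l k (by omega)
  choose n P s t hst hest hn hP0 hPn hPne hPsub hPmeet using hlist
  have hmem : ∀ e v, v ∈ e.1 ↔ v = s e ∨ v = t e := fun e v => by rw [hest e, Sym2.mem_iff]
  have hinter : ∀ e f x, e ≠ f → x ∈ D.arc e.1 → x ∈ D.arc f.1 →
      (P e 0 = x ∨ P e (n e) = x) ∧ (P f 0 = x ∨ P f (n f) = x) := by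
    intro e f x hef hxe hxf
    obtain ⟨w, hwe, hwf, rfl⟩ :=
      D.inter_subset e.1 e.2 f.1 f.2 (fun h => hef (Subtype.ext h)) ⟨hxe, hxf⟩
    rw [hmem] at hwe hwf
    rw [hP0, hPn, hP0, hPn]
    constructor
    · rcases hwe with rfl | rfl <;> simp
    · rcases hwf with rfl | rfl <;> simp
  have hends : ∀ e k x, k < n e → x ∈ segment ℝ (P e k) (P e (k + 1)) →
      (P e 0 = x ∨ P e (n e) = x) → (P e k = x ∨ P e (k + 1) = x) := by
    rintro e k x hk hx (h | h)
    · rcases Nat.eq_zero_or_pos k with rfl | hpos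
      · exact Or.inl h
      · exact Or.inl (hPmeet e 0 k x hpos hk (h ▸ left_mem_segment ℝ _ _) hx).2.symm
    · rcases Nat.lt_or_ge (k + 1) (n e) with h1 | h1
      · have hx2 : x ∈ segment ℝ (P e (n e - 1)) (P e (n e - 1 + 1)) := by
          rw [Nat.sub_add_cancel (hn e), h]; exact right_mem_segment ℝ _ _
        obtain ⟨e1, e2⟩ := hPmeet e k (n e - 1) x (by omega) (by have := hn e; omega) hx hx2
        rw [e1] at e2
        exact Or.inr e2.symm
      · have : k + 1 = n e := by omega
        rw [this]; exact Or.inr h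
  set ι := Σ e : G.edgeSet, Fin (n e)
  set a : ι → ℝ × ℝ := fun i => P i.1 i.2
  set b : ι → ℝ × ℝ := fun i => P i.1 (i.2 + 1)
  obtain ⟨up, hup⟩ := exists_side_function_of_segments hW a b (fun i => hPne i.1 i.2 i.2.2)
    (by
      rintro ⟨e, k⟩ ⟨f, k'⟩ x hne hx1 hx2
      by_cases hef : e = f
      · subst hef
        have hkk : k.1 ≠ k'.1 := fun h => hne (by rw [Fin.ext h])
        rcases lt_or_gt_of_ne hkk with h | h
        · obtain ⟨e1, e2⟩ := hPmeet e k k' x h k'.2 hx1 hx2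
          exact ⟨Or.inr (by simp [b, ← e1, e2]), Or.inl e2.symm⟩
        · obtain ⟨e1, e2⟩ := hPmeet e k' k x h k.2 hx2 hx1
          exact ⟨Or.inl e2.symm, Or.inr (by simp [b, ← e1, e2])⟩
      · have := hinter e f x hef (hPsub e k k.2 hx1) (hPsub f k' k'.2 hx2)
        exact ⟨hends e k x k.2 hx1 this.1, hends f k' x k'.2 hx2 this.2⟩)
    (fun i => γ i.1)
    (by
      intro p
      refine (sum_sigma_ends hW n P hPne γ p).trans ?_
      simp only [hP0, hPn]
      by_cases hp : ∃ v, D.pos v = p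
      · obtain ⟨v, rfl⟩ := hp
        rw [sum_ite_ends_eq_sum_mem D.pos_injective hst]
        simpa only [← hest] using hγ v
      · refine Finset.sum_eq_zero fun e _ => ?_
        rw [if_neg fun h => hp ⟨_, h⟩, if_neg fun h => hp ⟨_, h⟩, add_zero])
  set β : ι → W → ZMod 2 := fun i f =>
    (if up i = f then (1 : ZMod 2) else 0) + (if up i + γ i.1 = f then 1 else 0) with hβ
  -- At an inner break point of an arc exactly two segments end, so the vanishing sum there forces
  -- equal indicators. Hence the indicator is constant along the arc and its first segment can
  -- represent the edge.
  have hstep : ∀ e k (h : k + 1 < n e) f, β ⟨e, ⟨k, by omega⟩⟩ f = β ⟨e, ⟨k + 1, h⟩⟩ f := by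
    intro e k h f
    have h0 := hup (P e (k + 1)) f
    have hnd : ∀ j, j ≤ n e → P e j = P e (k + 1) → j = k + 1 := by
      intro j hj hP
      rcases lt_trichotomy j (k + 1) with h1 | h1 | h1
      · exfalso
        have h2 := (hPmeet e j (k + 1) (P e j) h1 h (left_mem_segment ℝ _ _)
          (hP ▸ left_mem_segment ℝ _ _)).1
        have : j = k := by omega
        subst this
        exact hPne e j (by omega) hP
      · exact h1
      · exfalso
        obtain ⟨j, rfl⟩ : ∃ j', j = j' + 1 := ⟨j - 1, by omega⟩
        rcases Nat.lt_or_ge (k + 1) j with h3 | h3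
        · have h2 := (hPmeet e (k + 1) j (P e (k + 1)) h3 (by omega) (left_mem_segment ℝ _ _)
            (hP ▸ right_mem_segment ℝ _ _))
          exact hPne e j (by omega) (h2.2.symm.trans hP.symm)
        · have : j = k + 1 := by omega
          subst this
          exact hPne e (k + 1) (by omega) hP.symm
    have hset : (Finset.univ.filter fun i : ι => a i = P e (k + 1) ∨ b i = P e (k + 1)) =
        {⟨e, ⟨k, by omega⟩⟩, ⟨e, ⟨k + 1, h⟩⟩} := by
      ext ⟨f, j⟩
      simp only [Finset.mem_filter, Finset.mem_univ, true_and, Finset.mem_insert,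
        Finset.mem_singleton]
      constructor
      · intro hx
        by_cases hef : f = e
        · subst hef
          rcases hx with hx | hx
          · right
            have := hnd j j.2.le hx
            congr 1
            exact Fin.ext this
          · left
            have := hnd (j + 1) j.2 hx
            congr 1
            exact Fin.ext (by simpa using this)
        · exfalso
          have hxf : P e (k + 1) ∈ D.arc f.1 := by
            apply hPsub f j j.2
            rcases hx with hx | hx
            · rw [← hx]; exact left_mem_segment ℝ _ _
            · rw [← hx]; exact right_mem_segment ℝ _ _
          have hxe : P e (k + 1) ∈ D.arc e.1 := hPsub e _ h (left_mem_segment ℝ _ _)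
          rcases (hinter f e _ hef hxf hxe).2 with h1 | h1
          · have := hnd 0 (by omega) h1; omega
          · have := hnd (n e) le_rfl h1; omega
      · rintro (hx | hx)
        · cases hx; exact Or.inr rfl
        · cases hx; exact Or.inl rfl
    have hne : (⟨e, ⟨k, by omega⟩⟩ : ι) ≠ ⟨e, ⟨k + 1, h⟩⟩ := fun h => by
      have := congrArg (fun i : ι => (i.2 : ℕ)) h
      simp at this
    rw [hset, Finset.sum_pair hne] at h0
    have h2 := CharTwo.add_self_eq_zero (β ⟨e, ⟨k + 1, h⟩⟩ f)
    exact add_right_cancel (h0.trans h2.symm)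
  have hconst : ∀ e k (h : k < n e) f, β ⟨e, ⟨k, h⟩⟩ f = β ⟨e, ⟨0, hn e⟩⟩ f := by
    intro e k
    induction k with
    | zero => intros; rfl
    | succ k ih => intro h f; rw [← hstep e k h f, ih]
  refine ⟨fun e => up ⟨e, ⟨0, hn e⟩⟩, fun v f => ?_⟩
  have h1 := sum_sigma_ends CharTwo.add_self_eq_zero n P hPne
    (fun e => β ⟨e, ⟨0, hn e⟩⟩ f) (D.pos v)
  simp only [hP0, hPn] at h1
  rw [sum_ite_ends_eq_sum_mem D.pos_injective hst] at h1
  simp only [← hest] at h1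
  refine h1.symm.trans (Eq.trans ?_ (hup (D.pos v) f))
  exact Finset.sum_congr rfl fun i _ => (hconst i.1 i.2 i.2.2 f).symm

/-! ### The Euler-type inequality from the cycle space -/

/-- A nonzero element of the binary cycle space has at least as many edges as the girth. -/
theorem le_card_support_of_even {V : Type*} [Fintype V] [DecidableEq V] {G : SimpleGraph V}
    [Fintype G.edgeSet] {g : ℕ} (hgirth : (g : ℕ∞) ≤ G.egirth) (S : G.edgeSet → ZMod 2)
    (hS : ∀ v, ∑ e with v ∈ e.1, S e = 0) (hne : S ≠ 0) :
    g ≤ (Finset.univ.filter fun e => S e ≠ 0).card := by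
  classical
  set s : Set (Sym2 V) := {e | ∃ h : e ∈ G.edgeSet, S ⟨e, h⟩ ≠ 0} with hs
  set H := SimpleGraph.fromEdgeSet s with hH
  have hadj : ∀ u v, H.Adj u v ↔ ∃ h : G.Adj u v, S ⟨s(u, v), h⟩ ≠ 0 := by
    intro u v
    rw [hH, SimpleGraph.fromEdgeSet_adj]
    exact ⟨fun h => h.1, fun h => ⟨h, h.1.ne⟩⟩
  have hHG : H ≤ G := fun u v h => ((hadj u v).1 h).1
  have hcyc : ¬ H.IsAcyclic := by
    intro hac
    obtain ⟨e, he⟩ : ∃ e, S e ≠ 0 := by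
      by_contra! h
      exact hne (funext h)
    obtain ⟨⟨x, y⟩, hxy⟩ := e
    have hadjxy : H.Adj x y := (hadj x y).2 ⟨hxy, he⟩
    have : Nonempty V := ⟨x⟩
    -- Evenness at the start of a longest path gives a second support edge there: its far end either
    -- lies on the path, contradicting acyclicity, or prolongs the path.
    obtain ⟨u, v, p, hp, hmax⟩ := SimpleGraph.Walk.exists_isPath_forall_isPath_length_le_length H
    cases p with
    | nil =>
      have := hmax x y (SimpleGraph.Walk.cons hadjxy SimpleGraph.Walk.nil)
        (by simp [hadjxy.ne])
      simp at this
    | @cons _ w _ huw q =>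
      obtain ⟨hG, hSw⟩ := (hadj u w).1 huw
      have hex : ∃ e : G.edgeSet, u ∈ e.1 ∧ e ≠ ⟨s(u, w), hG⟩ ∧ S e ≠ 0 := by
        by_contra! h
        refine hSw ?_
        rw [← hS u]
        symm
        refine Finset.sum_eq_single_of_mem _ (by simp) fun e he hne => h e ?_ hne
        simpa using he
      obtain ⟨⟨e, he⟩, hu, hne, hSe⟩ := hex
      obtain ⟨z, rfl⟩ := hu
      have huz : H.Adj u z := (hadj u z).2 ⟨he, hSe⟩
      by_cases hz : z ∈ (SimpleGraph.Walk.cons huw q).support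
      · have := hac.eq_snd_of_adj_start hp huz hz
        simp only [SimpleGraph.Walk.snd_cons] at this
        subst this
        exact hne rfl
      · have := hmax z v (SimpleGraph.Walk.cons huz.symm (SimpleGraph.Walk.cons huw q))
          (hp.cons hz)
        simp at this
  simp only [SimpleGraph.IsAcyclic, not_forall, not_not] at hcyc
  obtain ⟨a, c, hc⟩ := hcyc
  have h1 : g ≤ c.length := by
    have := hgirth.trans (SimpleGraph.egirth_le_length (hc.mapLe hHG))
    simpa using this
  refine h1.trans ?_
  rw [← SimpleGraph.Walk.length_edges, ← List.toFinset_card_of_nodup hc.edges_nodup,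
    ← Finset.card_map (Function.Embedding.subtype _)]
  refine Finset.card_le_card fun e he => ?_
  have he' : e ∈ H.edgeSet := c.edges_subset_edgeSet (List.mem_toFinset.1 he)
  rw [hH, SimpleGraph.edgeSet_fromEdgeSet] at he'
  obtain ⟨h, h2⟩ := he'.1
  exact Finset.mem_map.2 ⟨⟨e, h⟩, by simpa using h2, rfl⟩

/-- Double counting: a linearly independent family of vectors over the field with two elements,
each coordinate being nonzero in at most two of them, together with its sum. -/
theorem mul_card_add_one_le {E : Type*} [Fintype E] [DecidableEq E] {g : ℕ}
    (T : Finset (E → ZMod 2)) (hT : ∀ e, (T.filter fun β => β e ≠ 0).card ≤ 2)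
    (hg : ∀ β ∈ T, g ≤ (Finset.univ.filter fun e => β e ≠ 0).card)
    (hg0 : g ≤ (Finset.univ.filter fun e => (∑ β ∈ T, β) e ≠ 0).card) :
    g * (T.card + 1) ≤ 2 * Fintype.card E := by
  have h1 : g * T.card ≤ ∑ β ∈ T, (Finset.univ.filter fun e => β e ≠ 0).card := by
    rw [mul_comm, ← smul_eq_mul]
    exact Finset.card_nsmul_le_sum _ _ _ hg
  have h2 : ∑ β ∈ T, (Finset.univ.filter fun e => β e ≠ 0).card =
      ∑ e, (T.filter fun β => β e ≠ 0).card := by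
    simp only [Finset.card_filter]
    exact Finset.sum_comm
  have h3 : ∑ e, ((T.filter fun β => β e ≠ 0).card + if (∑ β ∈ T, β) e ≠ 0 then 1 else 0) ≤
      ∑ _e : E, 2 := by
    refine Finset.sum_le_sum fun e _ => ?_
    have hsum : (∑ β ∈ T, β) e = ((T.filter fun β => β e ≠ 0).card : ZMod 2) := by
      rw [Finset.sum_apply, Finset.card_filter, Nat.cast_sum]
      refine Finset.sum_congr rfl fun β _ => ?_
      generalize β e = z
      revert z
      decide
    rcases (hT e).lt_or_eq with h | h
    · split_ifs <;> omega
    -- A coordinate already covered twice vanishes in the sum.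
    · rw [hsum, h]
      simp [show (2 : ZMod 2) = 0 from rfl]
  rw [Finset.sum_add_distrib, ← Finset.card_filter, ← h2] at h3
  simp only [Finset.sum_const, Finset.card_univ, smul_eq_mul] at h3
  rw [mul_add, mul_one]
  omega

/-- The boundary map of a graph over the field with two elements. -/
def boundary {V : Type*} [DecidableEq V] (G : SimpleGraph V) [Fintype G.edgeSet] :
    (G.edgeSet → ZMod 2) →ₗ[ZMod 2] (V → ZMod 2) where
  toFun S v := ∑ e with v ∈ e.1, S e
  map_add' S T := by ext v; simp [Finset.sum_add_distrib]
  map_smul' c S := by ext v; simp [Finset.mul_sum]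

/-- The consequence of Euler's formula for plane graphs of minimum degree at least two and girth
at least `g`. -/
theorem IsPlanar.mul_card_edges_lt {V : Type*} [Fintype V] [Nonempty V] {G : SimpleGraph V}
    [Fintype G.edgeSet] (hG : IsPlanar G) {g : ℕ} (hgirth : (g : ℕ∞) ≤ G.egirth)
    (hE : Fintype.card V ≤ Fintype.card G.edgeSet) :
    g * Fintype.card G.edgeSet < g * Fintype.card V + 2 * Fintype.card G.edgeSet := by
  classical
  obtain ⟨D⟩ := hG
  set Z := LinearMap.ker (boundary G) with hZ
  have hmemZ : ∀ S, S ∈ Z ↔ ∀ v, ∑ e with v ∈ e.1, S e = 0 := fun S => by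
    rw [hZ, LinearMap.mem_ker]
    exact ⟨fun h v => congrFun h v, fun h => funext h⟩
  obtain ⟨up, hup⟩ := D.exists_side_function (W := Z → ZMod 2)
    (fun w => CharTwo.add_self_eq_zero w) (fun e S => S.1 e) (by
      intro v
      ext S
      rw [Finset.sum_apply]
      exact (hmemZ S.1).1 S.2 v)
  set B : (Z → ZMod 2) → G.edgeSet → ZMod 2 := fun f e =>
    (if up e = f then (1 : ZMod 2) else 0) +
      (if up e + (fun S : Z => S.1 e) = f then 1 else 0) with hB
  have hBZ : ∀ f, B f ∈ Z := fun f => (hmemZ _).2 fun v => hup v f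
  have hspan : Submodule.span (ZMod 2) (Set.range B) = Z := by
    refine le_antisymm (Submodule.span_le.2 (by rintro _ ⟨f, rfl⟩; exact hBZ f)) fun S hS => ?_
    -- At e the two side labels contribute `up e` and `up e` plus evaluation at e, both taken at S;
    -- their sum is S e.
    have : S = ∑ f : Z → ZMod 2, f ⟨S, hS⟩ • B f := by
      ext e
      rw [Finset.sum_apply]
      simp only [Pi.smul_apply, hB, smul_eq_mul, mul_add, mul_ite, mul_one, mul_zero,
        Finset.sum_add_distrib, Finset.sum_ite_eq, Finset.mem_univ, if_true, Pi.add_apply]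
      rw [← add_assoc, CharTwo.add_self_eq_zero, zero_add]
    rw [this]
    exact Submodule.sum_mem _ fun f _ =>
      Submodule.smul_mem _ _ (Submodule.subset_span ⟨f, rfl⟩)
  obtain ⟨b, hbB, hb, hli⟩ := exists_linearIndependent (ZMod 2) (Set.range B)
  have hT : Module.finrank (ZMod 2) Z = b.toFinset.card := by
    rw [← hspan, ← hb, finrank_span_set_eq_card hli]
  -- Bounding the rank of the boundary map by |V| suffices: the extra set in `key` supplies the
  -- strictness, and no components need counting.
  have hrank : Fintype.card G.edgeSet ≤ b.toFinset.card + Fintype.card V := by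
    have h1 := (boundary G).finrank_range_add_finrank_ker
    have h2 := Submodule.finrank_le (LinearMap.range (boundary G))
    rw [Module.finrank_fintype_fun_eq_card] at h1 h2
    rw [← hZ, hT] at h1
    omega
  have hV : 0 < Fintype.card V := Fintype.card_pos
  rcases Finset.eq_empty_or_nonempty b.toFinset with h0 | ⟨β0, hβ0⟩
  · rw [h0, Finset.card_empty, zero_add] at hrank
    have : Fintype.card G.edgeSet = Fintype.card V := le_antisymm hrank hE
    rw [this]
    omega
  · have hTZ : ∀ β ∈ b.toFinset, β ∈ Z := by
      intro β hβ
      obtain ⟨f, rfl⟩ := hbB (Set.mem_toFinset.1 hβ)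
      exact hBZ f
    have key : g * (b.toFinset.card + 1) ≤ 2 * Fintype.card G.edgeSet := by
      refine mul_card_add_one_le b.toFinset (fun e => ?_) (fun β hβ => ?_) ?_
      · have hsub : (b.toFinset.filter fun β => β e ≠ 0) ⊆
            ({up e, up e + fun S : Z => S.1 e} : Finset (Z → ZMod 2)).image B := by
          intro β hβ
          rw [Finset.mem_filter, Set.mem_toFinset] at hβ
          obtain ⟨f, rfl⟩ := hbB hβ.1
          refine Finset.mem_image_of_mem B ?_
          by_contra hf
          simp only [Finset.mem_insert, Finset.mem_singleton, not_or] at hf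
          exact hβ.2 (by simp only [hB]; rw [if_neg (Ne.symm hf.1), if_neg (Ne.symm hf.2), add_zero])
        exact (Finset.card_le_card hsub).trans (Finset.card_image_le.trans Finset.card_le_two)
      · refine le_card_support_of_even hgirth β ((hmemZ β).1 (hTZ β hβ)) ?_
        exact hli.ne_zero ⟨β, Set.mem_toFinset.1 hβ⟩
      · refine le_card_support_of_even hgirth _
          ((hmemZ _).1 (Submodule.sum_mem _ hTZ)) fun h => ?_
        rw [linearIndependent_iff'] at hli
        have hsum : ∑ i : b, (1 : ZMod 2) • (i : G.edgeSet → ZMod 2) = 0 := by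
          rw [← h]
          simp only [one_smul]
          exact (Finset.sum_subtype b.toFinset (fun x => Set.mem_toFinset) (fun x => x)).symm
        exact one_ne_zero (hli Finset.univ (fun _ => 1) hsum ⟨β0, Set.mem_toFinset.1 hβ0⟩
          (Finset.mem_univ _))
    have hgpos : 0 < g ∨ g = 0 := Nat.eq_zero_or_pos g |>.symm
    rcases hgpos with hgpos | rfl
    · have := Nat.mul_le_mul_left g hrank
      rw [mul_add] at this
      rw [mul_add, mul_one] at key
      omega
    · omega

/-! ### Discharging -/

section Discharging

variable {V : Type*} [Fintype V] (G : SimpleGraph V) [DecidableRel G.Adj]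

/-- `u` has degree two, and so has some neighbour of `u` other than `w`. -/
def IsTypeTwo (w u : V) : Prop :=
  G.degree u = 2 ∧ ∃ x, G.Adj u x ∧ x ≠ w ∧ G.degree x = 2

open Classical in
/-- The number of neighbours of degree two. -/
noncomputable def numTypeOne (w : V) : ℕ :=
  ((G.neighborFinset w).filter fun u => G.degree u = 2).card

open Classical in
/-- The number of neighbours of degree two that have another neighbour of degree two. -/
noncomputable def numTypeTwo (w : V) : ℕ :=
  ((G.neighborFinset w).filter fun u => IsTypeTwo G w u).card

/-- The number of neighbours of degree at least `K`. -/
def numBig (K : ℕ) (w : V) : ℕ := ((G.neighborFinset w).filter fun u => K ≤ G.degree u).card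

theorem numTypeTwo_le (w : V) : numTypeTwo G w ≤ numTypeOne G w := by
  classical
  exact Finset.card_le_card (Finset.monotone_filter_right _ fun u _ h => h.1)

theorem numTypeOne_add_numBig_le {K : ℕ} (hK : 3 ≤ K) (w : V) :
    numTypeOne G w + numBig G K w ≤ G.degree w := by
  classical
  rw [numTypeOne, numBig, ← Finset.card_union_of_disjoint, ← G.card_neighborFinset_eq_degree w]
  · exact Finset.card_le_card
      (Finset.union_subset (Finset.filter_subset _ _) (Finset.filter_subset _ _))
  · rw [Finset.disjoint_filter]
    intro u _ h
    omega

variable {G}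

theorem hasDegreePath_three {a b c : V} (hab : G.Adj a b) (hbc : G.Adj b c) (hac : a ≠ c) :
    HasDegreePath G [G.degree a, G.degree b, G.degree c] :=
  ⟨a, c, .cons hab (.cons hbc .nil), by simp [hab.ne, hbc.ne, hac], by simp⟩

theorem hasDegreePath_four {a b c d : V} (hab : G.Adj a b) (hbc : G.Adj b c) (hcd : G.Adj c d)
    (hac : a ≠ c) (had : a ≠ d) (hbd : b ≠ d) :
    HasDegreePath G [G.degree a, G.degree b, G.degree c, G.degree d] :=
  ⟨a, d, .cons hab (.cons hbc (.cons hcd .nil)),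
    by simp [hab.ne, hbc.ne, hcd.ne, hac, had, hbd], by simp⟩

open Classical in
variable (G) in
/-- The charge that `v` sends to its neighbour `u`: vertices of degree at least `K` send two units
to each neighbour, the other vertices of degree at least three one or two units to their
neighbours of degree two. -/
noncomputable def sentCharge (K : ℕ) (v u : V) : ℤ :=
  if K ≤ G.degree v then 2 else if G.degree v = 2 then 0 else
    if IsTypeTwo G v u then 2 else if G.degree u = 2 then 1 else 0

theorem sentCharge_nonneg (K : ℕ) (v u : V) : 0 ≤ sentCharge G K v u := by
  unfold sentCharge
  split_ifs <;> norm_num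

theorem sentCharge_le_two (K : ℕ) (v u : V) : sentCharge G K v u ≤ 2 := by
  unfold sentCharge
  split_ifs <;> norm_num

theorem sum_sentCharge_of_lt {K : ℕ} {v : V} (h3 : 3 ≤ G.degree v) (hK : G.degree v < K) :
    ∑ u ∈ G.neighborFinset v, sentCharge G K v u = numTypeOne G v + numTypeTwo G v := by
  classical
  rw [numTypeOne, numTypeTwo, Finset.card_filter, Finset.card_filter]
  push_cast
  rw [← Finset.sum_add_distrib]
  refine Finset.sum_congr rfl fun u _ => ?_
  rw [sentCharge, if_neg hK.not_ge, if_neg (by omega)]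
  by_cases h2 : IsTypeTwo G v u
  · simp [h2, h2.1]
  · simp [h2]

theorem two_mul_numBig_le (K : ℕ) (v : V) :
    2 * (numBig G K v : ℤ) ≤ ∑ u ∈ G.neighborFinset v, sentCharge G K u v := by
  classical
  rw [numBig, Finset.card_filter]
  push_cast
  rw [Finset.mul_sum]
  refine Finset.sum_le_sum fun u _ => ?_
  by_cases h : K ≤ G.degree u
  · simp [sentCharge, h]
  · simpa [h] using sentCharge_nonneg K u v

theorem two_le_received {K : ℕ}
    (h222 : ¬ HasDegreePath G [2, 2, 2]) {v : V} (hv : G.degree v = 2) :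
    2 ≤ ∑ u ∈ G.neighborFinset v, sentCharge G K u v := by
  classical
  obtain ⟨x, y, hxy, hN⟩ := Finset.card_eq_two.1 ((G.card_neighborFinset_eq_degree v).trans hv)
  have hx : G.Adj v x := by rw [← G.mem_neighborFinset, hN]; simp
  have hy : G.Adj v y := by rw [← G.mem_neighborFinset, hN]; simp
  -- If one neighbour has degree two, the other does not, since (2,2,2)-paths are excluded, and it
  -- alone sends both units.
  have key : ∀ x y, G.Adj v x → G.Adj v y → x ≠ y → G.degree x = 2 → sentCharge G K y v = 2 := by
    intro x y hx hy hxy hdx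
    have hdy : G.degree y ≠ 2 := fun hdy => h222 (by
      have := hasDegreePath_three hx.symm hy hxy
      rwa [hv, hdx, hdy] at this)
    have : IsTypeTwo G y v := ⟨hv, x, hx, hxy, hdx⟩
    simp [sentCharge, hdy, this]
  have key1 : ∀ x, G.degree x ≠ 2 → 1 ≤ sentCharge G K x v := by
    intro x hdx
    unfold sentCharge
    split_ifs <;> norm_num
  rw [hN, Finset.sum_pair hxy]
  by_cases hdx : G.degree x = 2
  · have := key x y hx hy hxy hdx
    have := sentCharge_nonneg (G := G) K x v
    omega
  · by_cases hdy : G.degree y = 2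
    · have := key y x hy hx hxy.symm hdy
      have := sentCharge_nonneg (G := G) K y v
      omega
    · have := key1 x hdx
      have := key1 y hdy
      omega

theorem sum_sent_eq_sum_received (φ : V → V → ℤ) :
    ∑ v, ∑ u ∈ G.neighborFinset v, φ v u = ∑ v, ∑ u ∈ G.neighborFinset v, φ u v :=
  Finset.sum_comm' fun u v => by simp [G.adj_comm]

/-- The discharging argument: if there are few edges, some vertex of moderate degree has many
neighbours of degree two. -/
theorem exists_deficient_vertex {g K : ℕ} (hδ : ∀ v, 2 ≤ G.degree v) (hg : 6 ≤ g)
    (hgK : 2 * g + 6 * K ≤ g * K)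
    (hlt : g * G.edgeFinset.card < g * Fintype.card V + 2 * G.edgeFinset.card)
    (h222 : ¬ HasDegreePath G [2, 2, 2]) :
    ∃ v, 3 ≤ G.degree v ∧ G.degree v < K ∧ g * G.degree v + 4 * numBig G K v <
      2 * g + 2 * G.degree v + 2 * (numTypeOne G v + numTypeTwo G v) := by
  by_contra! hcon
  -- One unit of `sentCharge` moves two units of charge. The initial charges total 2((g - 2)|E| -
  -- g|V|), which is negative by `hlt`.
  have hfinal : ∀ v, 0 ≤ ((g : ℤ) - 2) * G.degree v - 2 * g
      - 2 * ∑ u ∈ G.neighborFinset v, sentCharge G K v u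
      + 2 * ∑ u ∈ G.neighborFinset v, sentCharge G K u v := by
    intro v
    rcases lt_or_ge (G.degree v) K with hvK | hvK
    · rcases (hδ v).eq_or_lt with h2 | h3
      · have h1 := two_le_received (K := K) h222 h2.symm
        have h0 : ∑ u ∈ G.neighborFinset v, sentCharge G K v u = 0 :=
          Finset.sum_eq_zero fun u _ => by
            rw [sentCharge, if_neg hvK.not_ge, if_pos h2.symm]
        rw [h0, ← h2]
        push_cast
        linarith
      · have h1 := hcon v h3 hvK
        have h2 := two_mul_numBig_le (G := G) K v
        rw [sum_sentCharge_of_lt h3 hvK]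
        zify at h1
        linarith
    · have h1 : ∑ u ∈ G.neighborFinset v, sentCharge G K v u ≤ 2 * G.degree v := by
        refine (Finset.sum_le_card_nsmul _ _ 2 fun u _ => sentCharge_le_two K v u).trans ?_
        rw [G.card_neighborFinset_eq_degree, nsmul_eq_mul, mul_comm]
      have h2 : 0 ≤ ∑ u ∈ G.neighborFinset v, sentCharge G K u v :=
        Finset.sum_nonneg fun u _ => sentCharge_nonneg K u v
      have h3 : ((g : ℤ) - 6) * K ≤ (g - 6) * G.degree v :=
        mul_le_mul_of_nonneg_left (by exact_mod_cast hvK) (by zify at hg; linarith)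
      zify at hgK
      linarith
  have hsum := Finset.sum_nonneg fun v (_ : v ∈ Finset.univ) => hfinal v
  rw [Finset.sum_add_distrib, Finset.sum_sub_distrib, Finset.sum_sub_distrib, ← Finset.mul_sum,
    ← Finset.mul_sum, ← Finset.mul_sum, ← Finset.mul_sum,
    sum_sent_eq_sum_received (fun v u => sentCharge G K v u),
    ← Nat.cast_sum, G.sum_degrees_eq_twice_card_edges, Finset.sum_const, Finset.card_univ,
    nsmul_eq_mul] at hsum
  zify at hlt
  push_cast at hsum
  linarith

end Discharging

/-! ### Disjoint legs from the girth -/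

section Spiders

variable {V : Type*} {G : SimpleGraph V}

theorem not_adj_ends_of_isPath (hg : 7 ≤ G.egirth) {u v : V} (p : G.Walk u v) (hp : p.IsPath)
    (h2 : 2 ≤ p.length) (h5 : p.length ≤ 5) : ¬ G.Adj v u := by
  intro h
  have hc : (SimpleGraph.Walk.cons h p).IsCycle := by
    rw [SimpleGraph.Walk.cons_isCycle_iff]
    refine ⟨hp, fun he => ?_⟩
    have := hp.length_eq_one_of_mem_edges (Sym2.eq_swap ▸ he)
    omega
  have := hg.trans (SimpleGraph.egirth_le_length hc)
  rw [SimpleGraph.Walk.length_cons] at this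
  have : 7 ≤ p.length + 1 := by exact_mod_cast this
  omega

/-- `w`, `a`, `b`, `c` are the vertices of a walk without immediate returns. -/
structure IsArm (G : SimpleGraph V) (w a b c : V) : Prop where
  adj₁ : G.Adj w a
  adj₂ : G.Adj a b
  adj₃ : G.Adj b c
  ne₁ : w ≠ b
  ne₂ : a ≠ c

theorem IsArm.ne₃ (hg : 7 ≤ G.egirth) {w a b c : V} (h : IsArm G w a b c) : w ≠ c := by
  obtain ⟨h1, h2, h3, h4, h5⟩ := h
  rintro rfl
  exact not_adj_ends_of_isPath hg (.cons h1 (.cons h2 .nil))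
    (by simp [h1.ne, h2.ne, h4]) (by simp) (by simp) h3

theorem IsArm.nodup (hg : 7 ≤ G.egirth) {w a b c : V} (h : IsArm G w a b c) :
    [w, a, b, c].Nodup := by
  simp [h.adj₁.ne, h.adj₂.ne, h.adj₃.ne, h.ne₁, h.ne₂, h.ne₃ hg]

/-- Any coincidence closes a cycle of length at most 6; length 6 occurs for c = c', whence the bound
7. -/
theorem IsArm.disjoint (hg : 7 ≤ G.egirth) {w a b c a' b' c' : V} (h : IsArm G w a b c)
    (h' : IsArm G w a' b' c') (haa : a ≠ a') : List.Disjoint [a, b, c] [a', b', c'] := by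
  have e12 : ∀ {a b c a' b' c'}, IsArm G w a b c → IsArm G w a' b' c' → a ≠ a' → a ≠ b' := by
    rintro a b c a' b' c' h h' haa rfl
    exact not_adj_ends_of_isPath hg (.cons h'.adj₁ (.cons h'.adj₂ .nil))
      (by simp [h'.adj₁.ne, h'.adj₂.ne, h'.ne₁]) (by simp) (by simp) h.adj₁.symm
  have e13 : ∀ {a b c a' b' c'}, IsArm G w a b c → IsArm G w a' b' c' → a ≠ a' → a ≠ c' := by
    rintro a b c a' b' c' h h' haa rfl
    exact not_adj_ends_of_isPath hg (.cons h'.adj₁ (.cons h'.adj₂ (.cons h'.adj₃ .nil)))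
      (by simp [h'.adj₁.ne, h'.adj₂.ne, h'.ne₁, h'.adj₃.ne, h'.ne₂, h.adj₁.ne])
      (by simp) (by simp) h.adj₁.symm
  have e22 : ∀ {a b c a' b' c'}, IsArm G w a b c → IsArm G w a' b' c' → a ≠ a' → b ≠ b' := by
    rintro a b c a' b' c' h h' haa rfl
    exact not_adj_ends_of_isPath hg (.cons h.adj₁ (.cons h.adj₂ (.cons h'.adj₂.symm .nil)))
      (by simp [h.adj₁.ne, h.adj₂.ne, h.ne₁, h'.adj₂.ne', haa, h'.adj₁.ne])
      (by simp) (by simp) h'.adj₁.symm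
  have e23 : ∀ {a b c a' b' c'}, IsArm G w a b c → IsArm G w a' b' c' → a ≠ a' → b ≠ c' := by
    rintro a b c a' b' c' h h' haa rfl
    exact not_adj_ends_of_isPath hg
      (.cons h.adj₁ (.cons h.adj₂ (.cons h'.adj₃.symm (.cons h'.adj₂.symm .nil))))
      (by simp [h.adj₁.ne, h.adj₂.ne, h.ne₁, h'.adj₂.ne', haa, h'.adj₁.ne, h'.adj₃.ne', h'.ne₁,
        h'.ne₂.symm, e12 h h' haa])
      (by simp) (by simp) h'.adj₁.symm
  have e33 : c ≠ c' := by
    rintro rfl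
    exact not_adj_ends_of_isPath hg
      (.cons h.adj₁ (.cons h.adj₂ (.cons h.adj₃ (.cons h'.adj₃.symm (.cons h'.adj₂.symm .nil)))))
      (by simp [h.adj₁.ne, h.adj₂.ne, h.ne₁, h.adj₃.ne, h.ne₂, h.ne₃ hg, h'.adj₂.ne', haa,
        h'.adj₁.ne, h'.adj₃.ne', h'.ne₁, h'.ne₂.symm, e12 h h' haa, e22 h h' haa,
        (e12 h' h haa.symm).symm])
      (by simp) (by simp) h'.adj₁.symm
  have s := haa.symm
  simp [List.disjoint_left, haa, e12 h h' haa, e13 h h' haa, e22 h h' haa, e23 h h' haa, e33,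
    (e12 h' h s).symm, (e13 h' h s).symm, (e23 h' h s).symm]

/-- `l` is an initial piece of an arm that leaves `w` through `u`. -/
def IsLegThrough (G : SimpleGraph V) (w u : V) (l : List V) : Prop :=
  ∃ b c, IsArm G w u b c ∧ l <+: [u, b, c]

theorem nodup_flatten_of_legs (hg : 7 ≤ G.egirth) {w : V} {us : List V} {paths : List (List V)}
    (hus : us.Nodup) (h : List.Forall₂ (IsLegThrough G w) us paths) :
    (w :: paths.flatten).Nodup := by
  have hw : ∀ l ∈ paths, ∃ u ∈ us, IsLegThrough G w u l := fun l hl => by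
    obtain ⟨i, hi, rfl⟩ := List.getElem_of_mem hl
    exact ⟨us[i]'(h.length_eq ▸ hi), List.getElem_mem _, h.get _ _⟩
  rw [List.nodup_cons, List.nodup_flatten]
  refine ⟨fun hmem => ?_, fun l hl => ?_, ?_⟩
  · obtain ⟨l, hl, hwl⟩ := List.mem_flatten.1 hmem
    obtain ⟨u, -, b, c, harm, hpre⟩ := hw l hl
    exact (List.nodup_cons.1 (harm.nodup hg)).1 (hpre.subset hwl)
  · obtain ⟨u, -, b, c, harm, hpre⟩ := hw l hl
    exact (List.nodup_cons.1 (harm.nodup hg)).2.sublist hpre.sublist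
  · clear hw
    induction h with
    | nil => simp
    | @cons u l us paths hul h ih =>
      rw [List.nodup_cons] at hus
      refine List.pairwise_cons.2 ⟨fun l' hl' => ?_, ih hus.2⟩
      obtain ⟨i, hi, rfl⟩ := List.getElem_of_mem hl'
      have hi' : i < us.length := h.length_eq ▸ hi
      obtain ⟨b', c', harm', hpre'⟩ : IsLegThrough G w us[i] paths[i] := h.get hi' hi
      obtain ⟨b, c, harm, hpre⟩ := hul
      have hne : u ≠ us[i] := fun h => hus.1 (h ▸ List.getElem_mem _)
      exact fun x hx hx' => harm.disjoint hg harm' hne (hpre.subset hx) (hpre'.subset hx')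

variable [Fintype V] [DecidableRel G.Adj]

variable (G) in
/-- The leg `L` of a spider can be realised through the neighbour `u` of `w`. -/
def FitsLeg (w u : V) (L : List (Set ℕ)) : Prop :=
  ∃ l, IsLegThrough G w u l ∧ List.Forall₂ (fun (x : V) (S : Set ℕ) => G.degree x ∈ S) l L

theorem hasSpider_of_fitsLeg (hg : 7 ≤ G.egirth) {w : V} {us : List V}
    {legs : List (List (Set ℕ))} (hus : us.Nodup) (hdeg : G.degree w = us.length)
    (h : List.Forall₂ (FitsLeg G w) us legs) : HasSpider G legs := by
  have hpaths : ∃ paths, List.Forall₂ (IsLegThrough G w) us paths ∧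
      List.Forall₂ (List.Forall₂ fun (x : V) (S : Set ℕ) => G.degree x ∈ S) paths legs := by
    clear hus hdeg
    induction h with
    | nil => exact ⟨[], .nil, .nil⟩
    | cons h _ ih =>
      obtain ⟨l, h1, h2⟩ := h
      obtain ⟨paths, h3, h4⟩ := ih
      exact ⟨l :: paths, .cons h1 h3, .cons h2 h4⟩
  obtain ⟨paths, h1, h2⟩ := hpaths
  refine ⟨w, paths, hdeg.trans h.length_eq, nodup_flatten_of_legs hg hus h1, fun l hl => ?_, h2⟩
  obtain ⟨i, hi, rfl⟩ := List.getElem_of_mem hl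
  obtain ⟨b, c, harm, hpre⟩ : IsLegThrough G w (us[i]'(h1.length_eq ▸ hi)) paths[i] := h1.get _ _
  have hchain : List.IsChain G.Adj [w, us[i]'(h1.length_eq ▸ hi), b, c] := by
    simp [harm.adj₁, harm.adj₂, harm.adj₃]
  exact hchain.prefix (List.cons_prefix_cons.2 ⟨rfl, hpre⟩)

theorem exists_adj_ne (hδ : ∀ v, 2 ≤ G.degree v) (u w : V) : ∃ x, G.Adj u x ∧ w ≠ x := by
  have : 1 < (G.neighborFinset u).card := by
    rw [G.card_neighborFinset_eq_degree]; exact hδ u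
  obtain ⟨x, hx, hne⟩ := Finset.exists_mem_ne this w
  exact ⟨x, by simpa using hx, hne.symm⟩

/-- Even a short leg must be a prefix of an arm of length three; minimum degree two provides the
extension. -/
theorem fitsLeg_single (hδ : ∀ v, 2 ≤ G.degree v) {w u : V} (h : G.Adj w u) {S : Set ℕ}
    (hS : G.degree u ∈ S) : FitsLeg G w u [S] := by
  obtain ⟨b, hub, hwb⟩ := exists_adj_ne hδ u w
  obtain ⟨c, hbc, huc⟩ := exists_adj_ne hδ b u
  exact ⟨[u], ⟨b, c, ⟨h, hub, hbc, hwb, huc⟩, by simp⟩, by simpa using hS⟩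

theorem fitsLeg_leg1 (hδ : ∀ v, 2 ≤ G.degree v) {w u : V} (h : G.Adj w u)
    (hu : G.degree u = 2) : FitsLeg G w u leg1 := by
  obtain ⟨b, hub, hwb⟩ := exists_adj_ne hδ u w
  obtain ⟨c, hbc, huc⟩ := exists_adj_ne hδ b u
  exact ⟨[u, b], ⟨b, c, ⟨h, hub, hbc, hwb, huc⟩, by simp⟩, by simp [leg1, hu]⟩

theorem fitsLeg_leg2 (hδ : ∀ v, 2 ≤ G.degree v) {w u : V} (h : G.Adj w u)
    (hu : IsTypeTwo G w u) : FitsLeg G w u leg2 := by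
  obtain ⟨hu2, b, hub, hbw, hb⟩ := hu
  obtain ⟨c, hbc, huc⟩ := exists_adj_ne hδ b u
  exact ⟨[u, b, c], ⟨b, c, ⟨h, hub, hbc, hbw.symm, huc⟩, by simp⟩, by simp [leg2, hu2, hb]⟩

theorem forall₂_replicate {α β : Type*} {R : α → β → Prop} {l : List α} {b : β}
    (h : ∀ a ∈ l, R a b) : List.Forall₂ R l (List.replicate l.length b) := by
  induction l with
  | nil => exact .nil
  | cons a l ih =>
    exact .cons (h a (by simp)) (ih fun x hx => h x (by simp [hx]))

open Classical in
-- Exactly a type 2 neighbours are used for long legs; any surplus joins the other neighbours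
-- outside S on the legs L.
theorem hasSpider_of_card (hg : 7 ≤ G.egirth) (hδ : ∀ v, 2 ≤ G.degree v) {w : V} {a b : ℕ}
    (S : Finset V) {A : Set ℕ} {L : List (Set ℕ)} (hS : S ⊆ G.neighborFinset w)
    (hA : ∀ u ∈ S, G.degree u ∈ A)
    (hL : ∀ u ∈ G.neighborFinset w \ S, FitsLeg G w u L)
    (ha : a ≤ ((G.neighborFinset w \ S).filter fun u => IsTypeTwo G w u).card)
    (hab : a + b + S.card = G.degree w) :
    HasSpider G (List.replicate a leg2 ++ List.replicate b L ++ List.replicate S.card [A]) := by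
  obtain ⟨T, hT, rfl⟩ := Finset.exists_subset_card_eq ha
  have hTN : T ⊆ G.neighborFinset w \ S := hT.trans (Finset.filter_subset _ _)
  set R := (G.neighborFinset w \ S) \ T with hR
  have hRcard : R.card = b := by
    rw [hR, Finset.card_sdiff_of_subset hTN, Finset.card_sdiff_of_subset hS,
      G.card_neighborFinset_eq_degree]
    omega
  subst hRcard
  have hadj : ∀ u, u ∈ G.neighborFinset w → G.Adj w u := fun u hu => by simpa using hu
  have hnd : (T.toList ++ R.toList ++ S.toList).Nodup := by
    rw [List.nodup_append', List.nodup_append']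
    refine ⟨⟨T.nodup_toList, R.nodup_toList, fun x h1 h2 => ?_⟩, S.nodup_toList, fun x h1 h2 => ?_⟩
    · rw [Finset.mem_toList] at h1 h2
      exact (Finset.mem_sdiff.1 h2).2 h1
    · rw [List.mem_append, Finset.mem_toList, Finset.mem_toList] at h1
      rw [Finset.mem_toList] at h2
      rcases h1 with h1 | h1
      · exact (Finset.mem_sdiff.1 (hTN h1)).2 h2
      · exact (Finset.mem_sdiff.1 (Finset.mem_sdiff.1 h1).1).2 h2
  refine hasSpider_of_fitsLeg (w := w) hg hnd (by simp; omega)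
    (List.rel_append (List.rel_append ?_ ?_) ?_)
  · rw [← T.length_toList]
    refine forall₂_replicate fun u hu => ?_
    rw [Finset.mem_toList] at hu
    exact fitsLeg_leg2 hδ (hadj u (Finset.mem_sdiff.1 (hTN hu)).1) (Finset.mem_filter.1 (hT hu)).2
  · rw [← R.length_toList]
    refine forall₂_replicate fun u hu => ?_
    rw [Finset.mem_toList] at hu
    exact hL u (Finset.mem_sdiff.1 hu).1
  · rw [← S.length_toList]
    refine forall₂_replicate fun u hu => ?_
    rw [Finset.mem_toList] at hu
    exact fitsLeg_single hδ (hadj u (hS hu)) (hA u hu)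

end Spiders

/-! ### From neighbour counts to configurations -/

section Assembly

variable {V : Type*} [Fintype V] {G : SimpleGraph V} [DecidableRel G.Adj]

theorem forall_degree_eq_two_of_numTypeOne_eq {w : V} (h1 : numTypeOne G w = G.degree w) {u : V}
    (hu : G.Adj w u) : G.degree u = 2 := by
  classical
  rw [numTypeOne, ← G.card_neighborFinset_eq_degree, Finset.card_filter_eq_iff] at h1
  exact h1 u (by simpa using hu)

theorem hasSpider_of_numTypeOne_eq (hg : 7 ≤ G.egirth) (hδ : ∀ v, 2 ≤ G.degree v) {w : V}
    {a b : ℕ} {L : List (Set ℕ)} (hL : ∀ u, G.Adj w u → G.degree u = 2 → FitsLeg G w u L)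
    (h1 : numTypeOne G w = G.degree w) (h2 : a ≤ numTypeTwo G w) (hab : a + b = G.degree w) :
    HasSpider G (List.replicate a leg2 ++ List.replicate b L) := by
  classical
  have := hasSpider_of_card hg hδ (w := w) (a := a) (b := b) ∅ (A := ∅) (L := L) (by simp)
    (by simp) (fun u hu => hL u (by simpa using hu)
      (forall_degree_eq_two_of_numTypeOne_eq h1 (by simpa using hu)))
    (by simpa [numTypeTwo] using h2) (by simpa using hab)
  simpa using this

/-- The one neighbour not of degree two has degree at least 3, and less than K because no neighbour
is big, so it fits A. -/
theorem hasSpider_of_numTypeOne_add_one_eq (hg : 7 ≤ G.egirth) (hδ : ∀ v, 2 ≤ G.degree v)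
    {w : V} {a b K : ℕ} {L : List (Set ℕ)} {A : Set ℕ}
    (hL : ∀ u, G.Adj w u → G.degree u = 2 → FitsLeg G w u L)
    (hA : ∀ d, 3 ≤ d → d < K → d ∈ A) (hbig : numBig G K w = 0)
    (h1 : numTypeOne G w + 1 = G.degree w) (h2 : a ≤ numTypeTwo G w)
    (hab : a + b + 1 = G.degree w) :
    HasSpider G (List.replicate a leg2 ++ List.replicate b L ++ [[A]]) := by
  classical
  set S := (G.neighborFinset w).filter fun u => ¬ G.degree u = 2 with hS
  have hcard : S.card = 1 := by
    have := Finset.card_filter_add_card_filter_not (s := G.neighborFinset w)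
      (fun u => G.degree u = 2)
    rw [G.card_neighborFinset_eq_degree, ← hS] at this
    rw [numTypeOne] at h1
    omega
  have hsdiff : G.neighborFinset w \ S = (G.neighborFinset w).filter fun u => G.degree u = 2 := by
    ext u
    simp [hS]
    tauto
  have h2' : a ≤ ((G.neighborFinset w \ S).filter fun u => IsTypeTwo G w u).card := by
    refine h2.trans (Finset.card_le_card fun u hu => ?_)
    rw [Finset.mem_filter] at hu
    rw [hsdiff, Finset.mem_filter, Finset.mem_filter]
    exact ⟨⟨hu.1, hu.2.1⟩, hu.2⟩
  have := hasSpider_of_card hg hδ (w := w) (a := a) (b := b) S (A := A) (L := L)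
    (Finset.filter_subset _ _)
    (fun u hu => by
      rw [hS, Finset.mem_filter] at hu
      rw [numBig, Finset.card_eq_zero, Finset.filter_eq_empty_iff] at hbig
      exact hA _ (lt_of_le_of_ne (hδ u) (Ne.symm hu.2)) (not_le.1 (hbig hu.1)))
    (fun u hu => by
      rw [hsdiff, Finset.mem_filter] at hu
      exact hL u (by simpa using hu.1) hu.2)
    h2' (by rw [hcard]; exact hab)
  rwa [hcard] at this

theorem exists_isTypeTwo {w : V} (h : 0 < numTypeTwo G w) :
    ∃ u x, G.Adj w u ∧ G.degree u = 2 ∧ G.Adj u x ∧ x ≠ w ∧ G.degree x = 2 := by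
  classical
  obtain ⟨u, hu⟩ := Finset.card_pos.1 h
  rw [Finset.mem_filter] at hu
  obtain ⟨h1, h2, x, h3, h4, h5⟩ := hu
  exact ⟨u, x, by simpa using h1, h2, h3, h4, h5⟩

theorem hasDegreePath_two_two {w : V} (h : 0 < numTypeTwo G w) :
    HasDegreePath G [2, 2, G.degree w] := by
  obtain ⟨u, x, hwu, hu, hux, hxw, hx⟩ := exists_isTypeTwo h
  have := hasDegreePath_three hux.symm hwu.symm hxw
  rwa [hu, hx] at this

theorem exists_ne_of_two_le_numTypeOne {w : V} (h : 2 ≤ numTypeOne G w) (u : V) :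
    ∃ y, G.Adj w y ∧ G.degree y = 2 ∧ y ≠ u := by
  classical
  obtain ⟨y, hy, hne⟩ := Finset.exists_mem_ne h u
  rw [Finset.mem_filter] at hy
  exact ⟨y, by simpa using hy.1, hy.2, hne⟩

theorem hasDegreePath_two_mid_two {w : V} (h : 2 ≤ numTypeOne G w) :
    HasDegreePath G [2, G.degree w, 2] := by
  obtain ⟨x, hwx, hx, -⟩ := exists_ne_of_two_le_numTypeOne h w
  obtain ⟨y, hwy, hy, hyx⟩ := exists_ne_of_two_le_numTypeOne h x
  have := hasDegreePath_three hwx.symm hwy hyx.symm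
  rwa [hx, hy] at this

theorem hasDegreePath_two_two_mid_two (hg : 7 ≤ G.egirth) {w : V} (h1 : 2 ≤ numTypeOne G w)
    (h2 : 0 < numTypeTwo G w) : HasDegreePath G [2, 2, G.degree w, 2] := by
  obtain ⟨u, x, hwu, hu, hux, hxw, hx⟩ := exists_isTypeTwo h2
  obtain ⟨y, hwy, hy, hyu⟩ := exists_ne_of_two_le_numTypeOne h1 u
  have hxy : x ≠ y := by
    rintro rfl
    exact not_adj_ends_of_isPath hg (.cons hwu (.cons hux .nil))
      (by simp [hwu.ne, hux.ne, hxw.symm]) (by simp) (by simp) hwy.symm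
  have := hasDegreePath_four hux.symm hwu.symm hwy hxw hxy hyu.symm
  rwa [hx, hu, hy] at this

theorem hasStar_of_numTypeOne_eq (hg : 7 ≤ G.egirth) (hδ : ∀ v, 2 ≤ G.degree v) {w : V} {a : ℕ}
    {A : Set ℕ} (hA : 2 ∈ A) (h1 : numTypeOne G w = G.degree w) (ha : G.degree w = a + 1) :
    HasStar G (List.replicate a {2} ++ [A]) := by
  classical
  have h2 := fun u (hu : G.Adj w u) => forall_degree_eq_two_of_numTypeOne_eq h1 hu
  obtain ⟨x, hx⟩ := Finset.card_pos.1
    (by rw [G.card_neighborFinset_eq_degree]; omega : 0 < (G.neighborFinset w).card)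
  have := hasSpider_of_card hg hδ (w := w) (a := 0) (b := a) {x} (A := A) (L := [{2}])
    (by simpa using hx) (fun u hu => by
      rw [Finset.mem_singleton.1 hu, h2 x (by simpa using hx)]; exact hA)
    (fun u hu => by
      have hwu : G.Adj w u := by simpa using (Finset.mem_sdiff.1 hu).1
      exact fitsLeg_single hδ hwu (h2 u hwu))
    (Nat.zero_le _) (by rw [Finset.card_singleton]; omega)
  simpa [HasStar] using this

end Assembly

/-- The vertex found by the discharging argument in a plane graph. -/
theorem IsPlanar.exists_deficient_vertex {V : Type*} [Fintype V] [Nonempty V] {G : SimpleGraph V}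
    [DecidableRel G.Adj] (hG : IsPlanar G) (hδ : ∀ v, 2 ≤ G.degree v) {g K : ℕ}
    (hgirth : (g : ℕ∞) ≤ G.egirth) (hg : 6 ≤ g) (hgK : 2 * g + 6 * K ≤ g * K)
    (h222 : ¬ HasDegreePath G [2, 2, 2]) :
    ∃ v, 3 ≤ G.degree v ∧ G.degree v < K ∧ g * G.degree v + 4 * numBig G K v <
      2 * g + 2 * G.degree v + 2 * (numTypeOne G v + numTypeTwo G v) := by
  classical
  refine LightSubgraph.exists_deficient_vertex hδ hg hgK ?_ h222
  have hE : Fintype.card V ≤ G.edgeFinset.card := by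
    have h1 := G.sum_degrees_eq_twice_card_edges
    have h2 := Finset.card_nsmul_le_sum Finset.univ (fun v => G.degree v) 2 fun v _ => hδ v
    rw [h1, Finset.card_univ, smul_eq_mul] at h2
    omega
  have := hG.mul_card_edges_lt hgirth (by rwa [← SimpleGraph.edgeFinset_card])
  rwa [← SimpleGraph.edgeFinset_card] at this

end LightSubgraph

/-! ### The four girth bounds -/

open LightSubgraph in
theorem mainTheorem9 {V : Type*} [Fintype V] (G : SimpleGraph V) [DecidableRel G.Adj]
    (hplanar : LightSubgraph.IsPlanar G) (hδ : G.minDegree = 2)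
    (g : ℕ) (hgirth : (g : ℕ∞) ≤ G.egirth) :
    (12 ≤ g →
      LightSubgraph.HasDegreePath G [2, 2, 2] ∨
      LightSubgraph.HasSpider G LightSubgraph.configA ∨
      LightSubgraph.HasSpider G LightSubgraph.configB) ∧
    (10 ≤ g →
      LightSubgraph.HasDegreePath G [2, 2, 2] ∨
      LightSubgraph.HasDegreePath G [2, 2, 3, 2] ∨
      LightSubgraph.HasStar G [{2}, {2}, {2}] ∨
      LightSubgraph.HasSpider G LightSubgraph.configC) ∧
    (9 ≤ g →
      LightSubgraph.HasDegreePath G [2, 2, 2] ∨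
      LightSubgraph.HasDegreePath G [2, 2, 3] ∨
      LightSubgraph.HasStar G [{2}, {2}, Set.Iic 5] ∨
      LightSubgraph.HasSpider G LightSubgraph.configD ∨
      LightSubgraph.HasSpider G LightSubgraph.configE ∨
      LightSubgraph.HasSpider G LightSubgraph.configH) ∧
    (8 ≤ g →
      LightSubgraph.HasDegreePath G [2, 2, 2] ∨
      LightSubgraph.HasDegreePath G [2, 2, 3] ∨
      LightSubgraph.HasDegreePath G [2, 3, 2] ∨
      LightSubgraph.HasSpider G LightSubgraph.configF ∨
      LightSubgraph.HasSpider G LightSubgraph.configG ∨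
      LightSubgraph.HasSpider G LightSubgraph.configI ∨
      LightSubgraph.HasSpider G LightSubgraph.configJ ∨
      LightSubgraph.HasSpider G LightSubgraph.configK ∨
      LightSubgraph.HasSpider G LightSubgraph.configL) := by
  have hdeg : ∀ v, 2 ≤ G.degree v := fun v => hδ ▸ G.minDegree_le_degree v
  -- The minimum degree of the empty graph is 0 by convention.
  have hne : Nonempty V := by
    by_contra h
    rw [not_nonempty_iff] at h
    rw [SimpleGraph.minDegree_of_subsingleton] at hδ
    omega
  have hle : ∀ {n : ℕ}, n ≤ g → (n : ℕ∞) ≤ G.egirth := fun h =>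
    (by exact_mod_cast h : ((_ : ℕ) : ℕ∞) ≤ (g : ℕ∞)).trans hgirth
  have hleg1 : ∀ {w : V}, ∀ u, G.Adj w u → G.degree u = 2 → FitsLeg G w u leg1 :=
    fun u hu h => fitsLeg_leg1 hdeg hu h
  have hleg0 : ∀ {w : V} {S : Set ℕ}, 2 ∈ S → ∀ u, G.Adj w u → G.degree u = 2 →
      FitsLeg G w u [S] := fun hS u hu h => fitsLeg_single hdeg hu (by rwa [h])
  refine ⟨fun hg => ?_, fun hg => ?_, fun hg => ?_, fun hg => ?_⟩ <;>
    refine or_iff_not_imp_left.2 fun h222 => ?_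
  · have hg7 : 7 ≤ G.egirth := hle (n := 7) (by omega)
    -- In all four parts g is replaced by its lower bound and K = 2g/(g - 6). With d the degree, n₁
    -- and n₂ the type counts and B the number of big neighbours, the deficiency reads 2(n₁ + n₂) >
    -- (g - 2)d - 2g + 4B; combined with n₂ ≤ n₁ and n₁ + B ≤ d it leaves few cases.
    obtain ⟨v, h3, hK, h⟩ := hplanar.exists_deficient_vertex hdeg (K := 4) (hle hg)
      (by norm_num) (by norm_num) h222
    have ht := numTypeTwo_le G v
    have hb := numTypeOne_add_numBig_le G (K := 4) (by norm_num) v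
    have hv : G.degree v = 3 := by omega
    rcases (by omega : (numTypeOne G v = G.degree v ∧ 1 ≤ numTypeTwo G v) ∨
      (numTypeOne G v + 1 = G.degree v ∧ 2 ≤ numTypeTwo G v ∧ numBig G 4 v = 0)) with h | h
    · exact Or.inl (hasSpider_of_numTypeOne_eq (w := v) (a := 1) (b := 2) hg7 hdeg hleg1 h.1 h.2
        (by omega))
    · exact Or.inr (hasSpider_of_numTypeOne_add_one_eq (a := 2) (b := 0) hg7 hdeg hleg1
        (fun d h1 h2 => by simp; omega) h.2.2 h.1 h.2.1 (by omega))
  · have hg7 : 7 ≤ G.egirth := hle (n := 7) (by omega)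
    obtain ⟨v, h3, hK, h⟩ := hplanar.exists_deficient_vertex hdeg (K := 5) (hle hg)
      (by norm_num) (by norm_num) h222
    have ht := numTypeTwo_le G v
    have hb := numTypeOne_add_numBig_le G (K := 5) (by norm_num) v
    rcases (by omega : G.degree v = 3 ∨ G.degree v = 4) with hv | hv
    · rcases (by omega : numTypeOne G v = G.degree v ∨
        (2 ≤ numTypeOne G v ∧ 0 < numTypeTwo G v)) with h | h
      · exact Or.inr (Or.inl (hasSpider_of_numTypeOne_eq (w := v) (a := 0) (b := 3) hg7 hdeg
          (hleg0 (Set.mem_singleton 2)) h (by omega) (by omega)))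
      · have := hasDegreePath_two_two_mid_two hg7 h.1 h.2
        rw [hv] at this
        exact Or.inl this
    · exact Or.inr (Or.inr (hasSpider_of_numTypeOne_eq (w := v) (a := 3) (b := 1) hg7 hdeg hleg1
        (by omega) (by omega) (by omega)))
  · have hg7 : 7 ≤ G.egirth := hle (n := 7) (by omega)
    refine or_iff_not_imp_left.2 fun h223 => ?_
    obtain ⟨v, h3, hK, h⟩ := hplanar.exists_deficient_vertex hdeg (K := 6) (hle hg)
      (by norm_num) (by norm_num) h222
    have ht := numTypeTwo_le G v
    have hb := numTypeOne_add_numBig_le G (K := 6) (by norm_num) v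
    rcases (by omega : G.degree v = 3 ∨ G.degree v = 4 ∨ G.degree v = 5) with hv | hv | hv
    · left
      -- A type 2 neighbour of a 3-vertex would give a (2,2,3)-path, so n₂ = 0 and n₁ ≥ 2.
      have h0 : ¬ 0 < numTypeTwo G v := fun h0 => h223 (hv ▸ hasDegreePath_two_two h0)
      rcases (by omega : numTypeOne G v = G.degree v ∨
        (numTypeOne G v + 1 = G.degree v ∧ numBig G 6 v = 0)) with h | h
      · exact hasStar_of_numTypeOne_eq hg7 hdeg (a := 2) (by norm_num) h hv
      · exact hasSpider_of_numTypeOne_add_one_eq (a := 0) (b := 2) hg7 hdeg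
          (hleg0 (Set.mem_singleton 2)) (fun d h1 h2 => by simp; omega) h.2 h.1 (by omega)
          (by omega)
    · right
      rcases (by omega : (numTypeOne G v = G.degree v ∧ 2 ≤ numTypeTwo G v) ∨
        (numTypeOne G v + 1 = G.degree v ∧ 3 ≤ numTypeTwo G v ∧ numBig G 6 v = 0)) with h | h
      · exact Or.inl (hasSpider_of_numTypeOne_eq (w := v) (a := 2) (b := 2) hg7 hdeg hleg1 h.1 h.2
          (by omega))
      · exact Or.inr (Or.inl (hasSpider_of_numTypeOne_add_one_eq (a := 3) (b := 0) hg7 hdeg hleg1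
          (fun d h1 h2 => by simp; omega) h.2.2 h.1 h.2.1 (by omega)))
    · exact Or.inr (Or.inr (Or.inr (hasSpider_of_numTypeOne_eq (w := v) (a := 4) (b := 1) hg7 hdeg hleg1
        (by omega) (by omega) (by omega))))
  · have hg7 : 7 ≤ G.egirth := hle (n := 7) (by omega)
    refine or_iff_not_imp_left.2 fun h223 => or_iff_not_imp_left.2 fun h232 => ?_
    obtain ⟨v, h3, hK, h⟩ := hplanar.exists_deficient_vertex hdeg (K := 8) (hle hg)
      (by norm_num) (by norm_num) h222
    have ht := numTypeTwo_le G v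
    have hb := numTypeOne_add_numBig_le G (K := 8) (by norm_num) v
    rcases (by omega : G.degree v = 3 ∨ G.degree v = 4 ∨ G.degree v = 5 ∨ G.degree v = 6 ∨
      G.degree v = 7) with hv | hv | hv | hv | hv
    · exfalso
      have h0 : ¬ 0 < numTypeTwo G v := fun h0 => h223 (hv ▸ hasDegreePath_two_two h0)
      exact h232 (hv ▸ hasDegreePath_two_mid_two (by omega))
    · rcases (by omega : (numTypeOne G v = G.degree v ∧ 1 ≤ numTypeTwo G v) ∨
        (numTypeOne G v + 1 = G.degree v ∧ 2 ≤ numTypeTwo G v ∧ numBig G 8 v = 0)) with h | h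
      · exact Or.inl (hasSpider_of_numTypeOne_eq (w := v) (a := 1) (b := 3) hg7 hdeg hleg1 h.1 h.2
          (by omega))
      · exact Or.inr (Or.inl (hasSpider_of_numTypeOne_add_one_eq (a := 2) (b := 1) hg7 hdeg hleg1
          (fun d h1 h2 => by simp; omega) h.2.2 h.1 h.2.1 (by omega)))
    · rcases (by omega : (numTypeOne G v = G.degree v ∧ 3 ≤ numTypeTwo G v) ∨
        (numTypeOne G v + 1 = G.degree v ∧ 4 ≤ numTypeTwo G v ∧ numBig G 8 v = 0)) with h | h
      · exact Or.inr (Or.inr (Or.inr (Or.inl (hasSpider_of_numTypeOne_eq (w := v) (a := 3) (b := 2) hg7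
          hdeg hleg1 h.1 h.2 (by omega)))))
      · exact Or.inr (Or.inr (Or.inl (hasSpider_of_numTypeOne_add_one_eq (a := 4) (b := 0) hg7
          hdeg hleg1 (fun d h1 h2 => by simp; omega) h.2.2 h.1 h.2.1 (by omega))))
    · exact Or.inr (Or.inr (Or.inr (Or.inr (Or.inl (hasSpider_of_numTypeOne_eq (w := v) (a := 5) (b := 1)
        hg7 hdeg hleg1 (by omega) (by omega) (by omega))))))
    · exact Or.inr (Or.inr (Or.inr (Or.inr (Or.inr (hasSpider_of_numTypeOne_eq (w := v) (a := 7) (b := 0)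
        hg7 hdeg hleg1 (by omega) (by omega) (by omega))))))
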